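/- Let $\mathcal H$ be a complex Hilbert space, with inner product $\langle\cdot,\cdot\rangle$ linear in the second argument, let $(U_t)_{t\in\mathbb R}$ be a strongly continuous unitary one-parameter group on $\mathcal H$, and let $J$ be a conjugation on $\mathcal H$ (an antilinear surjective isometry with $J^2=\mathbf 1$) such that $JU_t=U_tJ$ for all $t\in\mathbb R$. Let $P$ be the spectral measure of $U$, i.e. the projection-valued Borel measure on $\mathbb R$ with $U_t=\int_{\mathbb R}e^{itp}\,dP(p)$; put $A=\int_{\mathbb R}p\,dP(p)$, so that $U_t=e^{itA}$ and $e^{tA}=\int_{\mathbb R}e^{tp}\,dP(p)$ is a positive selfadjoint operator with domain $\mathcal D(e^{tA})=\{v\in\mathcal H:\int_{\mathbb R} e^{2tp}\,dP^v(p)<\infty\}$ for $t\in\mathbb R$, where $P^v(E)=\langle v,P(E)v\rangle$. Let $\mathcal H^J=\{v\in\mathcal H: Jv=v\}$, and let $\mathcal H^J_{\rm temp}$ be the set of those $v\in\mathcal H^J$ for which the measure $e^{\pi p}\,dP^v(p)$ is tempered, i.e. $\int_{\mathbb R}(1+|p|)^{-n}e^{\pi p}\,dP^v(p)<\infty$ for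 some $n\in\mathbb N$. Let $\mathcal H^\infty$ be the space of smooth vectors of $U$ (those $v$ for which $t\mapsto U_tv$ is $C^\infty$), with its Fréchet topology defined by the seminorms $v\mapsto\|A^nv\|$, $n\in\mathbb N_0$, and let $\mathcal H^{-\infty}$ be the space of continuous antilinear functionals on $\mathcal H^\infty$, with the weak-$*$-topology; $\mathcal H$ is embedded in $\mathcal H^{-\infty}$ by $v\mapsto\langle\cdot,v\rangle$. **Theorem.** For $v\in\mathcal H^J\cap\bigcap_{|t|<\pi/2}\mathcal D(e^{tA})$, the following are equivalent: (a) $v\in\mathcal H^J_{\rm temp}$. (b) Both limits $\beta^{\pm}(v)=\lim_{t\to\pm\pi/2}e^{-tA}v$ (with $|t|<\pi/2$) exist in $\mathcal H^{-\infty}$. (c) There exist $C,N>0$ such that $\|e^{\pm tA}v\|^2\le C\big(\tfrac{\pi}{2}-|t|\big)^{-N}$ for all $t\in\mathbb R$ with $|t|<\pi/2$. -/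

import Mathlib

open MeasureTheory Filter Topology Set
open scoped ENNReal ContDiff InnerProductSpace

noncomputable section

variable {H : Type*} [NormedAddCommGroup H] [InnerProductSpace ℂ H]

/-! ### Spectral measures on the real line -/

/-- A (projection-valued) spectral measure on the Borel subsets of `ℝ`, with values in the
orthogonal projections of the Hilbert space `H`. The values of `proj` on sets that are not Borel
play no role. -/
structure SpectralMeasure (H : Type*) [NormedAddCommGroup H] [InnerProductSpace ℂ H]
    [CompleteSpace H] where
  /-- The projection `P(E)`. -/
  proj : Set ℝ → H →L[ℂ] H
  isStarProjection : ∀ E, MeasurableSet E → IsStarProjection (proj E)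
  proj_univ : proj univ = 1
  proj_inter : ∀ E F, MeasurableSet E → MeasurableSet F → proj (E ∩ F) = proj E * proj F
  hasSum_proj : ∀ E : ℕ → Set ℝ, (∀ n, MeasurableSet (E n)) → Pairwise (Function.onFun Disjoint E) →
    ∀ v, HasSum (fun n => proj (E n) v) (proj (⋃ n, E n) v)

namespace SpectralMeasure

variable [CompleteSpace H] (P : SpectralMeasure H)

theorem proj_empty : P.proj ∅ = 0 := by
  ext v
  have h := P.hasSum_proj (fun _ => ∅) (fun _ => MeasurableSet.empty)
    (fun _ _ _ => disjoint_bot_left) v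
  have h2 := h.summable.tendsto_atTop_zero
  simpa using tendsto_nhds_unique tendsto_const_nhds h2

theorem proj_mul_of_disjoint {E F : Set ℝ} (hE : MeasurableSet E) (hF : MeasurableSet F)
    (h : Disjoint E F) : P.proj E * P.proj F = 0 := by
  rw [← P.proj_inter E F hE hF, h.inter_eq, P.proj_empty]

theorem inner_proj_proj {E F : Set ℝ} (hE : MeasurableSet E) (hF : MeasurableSet F) (v w : H) :
    ⟪P.proj E v, P.proj F w⟫_ℂ = ⟪v, P.proj (E ∩ F) w⟫_ℂ := by
  have h := (P.isStarProjection E hE).isSelfAdjoint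
  rw [P.proj_inter E F hE hF, mul_apply_eq_comp]
  exact (ContinuousLinearMap.isSelfAdjoint_iff_isSymmetric.1 h) v (P.proj F w)

theorem inner_proj_self {E : Set ℝ} (hE : MeasurableSet E) (v : H) :
    (⟪v, P.proj E v⟫_ℂ).re = ‖P.proj E v‖ ^ 2 := by
  have h := P.inner_proj_proj hE hE v v
  rw [inter_self] at h
  rw [← h, inner_self_eq_norm_sq_to_K]
  norm_cast

theorem proj_union {E F : Set ℝ} (hE : MeasurableSet E) (hF : MeasurableSet F)
    (h : Disjoint E F) : P.proj (E ∪ F) = P.proj E + P.proj F := by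
  ext v
  let S : ℕ → Set ℝ := fun n => if n = 0 then E else if n = 1 then F else ∅
  have hS : ⋃ n, S n = E ∪ F := by
    ext x
    simp only [mem_iUnion, mem_union, S]
    constructor
    · rintro ⟨n, hn⟩
      split_ifs at hn with h0 h1
      · exact Or.inl hn
      · exact Or.inr hn
      · exact absurd hn (notMem_empty x)
    · rintro (hx | hx)
      · exact ⟨0, by simpa using hx⟩
      · exact ⟨1, by simpa using hx⟩
  have h1 := P.hasSum_proj S (fun n => by dsimp only [S]; split_ifs <;> simp [hE, hF])
    (fun m n hmn => by
      simp only [Function.onFun, S]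
      split_ifs with a b c d <;> first | (exfalso; omega) | simp [h, h.symm]) v
  rw [hS] at h1
  have h2 : HasSum (fun n => P.proj (S n) v) (∑ n ∈ Finset.range 2, P.proj (S n) v) := by
    refine hasSum_sum_of_ne_finset_zero fun n hn => ?_
    have : ¬ n = 0 ∧ ¬ n = 1 := by
      simp only [Finset.mem_range] at hn
      omega
    simp [S, this.1, this.2, P.proj_empty]
  have h3 := h1.unique h2
  simpa [Finset.sum_range_succ, S] using h3

/-- The finite Borel measure `P^v(E) = ⟨v, P(E) v⟩`. -/
def scalar (v : H) : Measure ℝ :=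
  Measure.ofMeasurable (fun E _ => ENNReal.ofReal (⟪v, P.proj E v⟫_ℂ).re)
    (by simp [P.proj_empty])
    (by
      intro E hE hd
      have h := P.hasSum_proj E hE hd v
      have h1 : HasSum (fun n => (⟪v, P.proj (E n) v⟫_ℂ).re)
          (⟪v, P.proj (⋃ n, E n) v⟫_ℂ).re :=
        Complex.hasSum_re ((innerSL ℂ v).hasSum h)
      rw [← h1.tsum_eq]
      refine ENNReal.ofReal_tsum_of_nonneg (fun n => ?_) h1.summable
      rw [P.inner_proj_self (hE n)]
      positivity)

theorem scalar_apply (v : H) {E : Set ℝ} (hE : MeasurableSet E) :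
    P.scalar v E = ENNReal.ofReal (⟪v, P.proj E v⟫_ℂ).re :=
  Measure.ofMeasurable_apply E hE

theorem scalar_apply_norm (v : H) {E : Set ℝ} (hE : MeasurableSet E) :
    P.scalar v E = ENNReal.ofReal (‖P.proj E v‖ ^ 2) := by
  rw [P.scalar_apply v hE, P.inner_proj_self hE]

instance (v : H) : IsFiniteMeasure (P.scalar v) :=
  ⟨by rw [P.scalar_apply v MeasurableSet.univ]; exact ENNReal.ofReal_lt_top⟩

theorem scalar_zero : P.scalar 0 = 0 := by
  ext E hE
  simp [P.scalar_apply_norm 0 hE]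

theorem scalar_smul_le (c : ℂ) (v : H) :
    P.scalar (c • v) ≤ ENNReal.ofReal (‖c‖ ^ 2) • P.scalar v := by
  refine Measure.le_iff.2 fun E hE => ?_
  rw [Measure.smul_apply, P.scalar_apply_norm _ hE, P.scalar_apply_norm _ hE, smul_eq_mul,
    ← ENNReal.ofReal_mul (by positivity), map_smul, norm_smul, mul_pow]

theorem scalar_add_le (v w : H) :
    P.scalar (v + w) ≤ (2 : ℝ≥0∞) • (P.scalar v + P.scalar w) := by
  refine Measure.le_iff.2 fun E hE => ?_
  have h2 : (2 : ℝ≥0∞) = ENNReal.ofReal 2 := by simp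
  rw [Measure.smul_apply, Measure.add_apply, P.scalar_apply_norm _ hE, P.scalar_apply_norm _ hE,
    P.scalar_apply_norm _ hE, smul_eq_mul, ← ENNReal.ofReal_add (by positivity) (by positivity),
    h2, ← ENNReal.ofReal_mul (by positivity), map_add]
  refine ENNReal.ofReal_le_ofReal ?_
  have := norm_add_le (P.proj E v) (P.proj E w)
  have h0 := norm_nonneg (P.proj E v + P.proj E w)
  nlinarith [sq_nonneg (‖P.proj E v‖ - ‖P.proj E w‖)]

/-! ### The spectral integral `∫ f dP` -/

/-- The integral of a simple function against `P`, a bounded operator. -/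
def simpleIntegral (s : SimpleFunc ℝ ℂ) : H →L[ℂ] H :=
  ∑ y ∈ s.range, y • P.proj (s ⁻¹' {y})

theorem proj_preimage_finset {γ : Type*} (q : SimpleFunc ℝ γ) (S : Finset γ) :
    P.proj (q ⁻¹' (S : Set γ)) = ∑ z ∈ S, P.proj (q ⁻¹' {z}) := by
  classical
  induction S using Finset.induction_on with
  | empty => simp [P.proj_empty]
  | insert a S ha ih =>
    rw [Finset.sum_insert ha, ← ih, Finset.coe_insert, Set.insert_eq, preimage_union]
    refine P.proj_union (q.measurableSet_preimage _) (q.measurableSet_preimage _) ?_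
    refine Disjoint.preimage _ ?_
    simpa using ha

theorem simpleIntegral_map {γ : Type*} (q : SimpleFunc ℝ γ) (g : γ → ℂ) :
    P.simpleIntegral (q.map g) = ∑ z ∈ q.range, g z • P.proj (q ⁻¹' {z}) := by
  classical
  unfold simpleIntegral
  simp_rw [SimpleFunc.map_preimage_singleton, proj_preimage_finset, SimpleFunc.range_map,
    Finset.smul_sum]
  rw [← Finset.sum_fiberwise_of_maps_to (s := q.range) (t := q.range.image g) (g := g)
    (fun z hz => Finset.mem_image_of_mem g hz)]
  refine Finset.sum_congr rfl fun y _ => Finset.sum_congr rfl fun z hz => ?_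
  rw [(Finset.mem_filter.1 hz).2]

theorem simpleIntegral_sub (s t : SimpleFunc ℝ ℂ) :
    P.simpleIntegral (s - t) = P.simpleIntegral s - P.simpleIntegral t := by
  have hs : s = (s.pair t).map Prod.fst := by ext; rfl
  have ht : t = (s.pair t).map Prod.snd := by ext; rfl
  have hst : s - t = (s.pair t).map (fun z => z.1 - z.2) := by ext; rfl
  have h1 := P.simpleIntegral_map (s.pair t) Prod.fst
  have h2 := P.simpleIntegral_map (s.pair t) Prod.snd
  rw [← hs] at h1
  rw [← ht] at h2
  rw [hst, h1, h2, simpleIntegral_map]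
  simp_rw [sub_smul, Finset.sum_sub_distrib]

theorem norm_simpleIntegral (s : SimpleFunc ℝ ℂ) (v : H) :
    ‖P.simpleIntegral s v‖ = (eLpNorm s 2 (P.scalar v)).toReal := by
  have hA : ‖P.simpleIntegral s v‖ ^ 2 = ∑ y ∈ s.range, ‖y‖ ^ 2 * ‖P.proj (s ⁻¹' {y}) v‖ ^ 2 := by
    have h1 : (‖P.simpleIntegral s v‖ ^ 2 : ℝ)
        = (⟪P.simpleIntegral s v, P.simpleIntegral s v⟫_ℂ).re := by
      rw [inner_self_eq_norm_sq_to_K]; norm_cast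
    rw [h1, simpleIntegral, _root_.sum_apply, sum_inner, Complex.re_sum]
    refine Finset.sum_congr rfl fun y hy => ?_
    rw [inner_sum, Finset.sum_eq_single y]
    · rw [_root_.smul_apply, inner_self_eq_norm_sq_to_K, norm_smul,
        ← mul_pow]
      norm_cast
    · intro z _ hz
      rw [_root_.smul_apply, _root_.smul_apply, inner_smul_left,
        inner_smul_right, P.inner_proj_proj (s.measurableSet_preimage _)
        (s.measurableSet_preimage _), (Disjoint.preimage s (by simpa using hz.symm)).inter_eq,
        P.proj_empty]
      simp
    · exact fun h => absurd hy h
  have hB : eLpNorm s 2 (P.scalar v) ^ 2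
      = ENNReal.ofReal (∑ y ∈ s.range, ‖y‖ ^ 2 * ‖P.proj (s ⁻¹' {y}) v‖ ^ 2) := by
    have h1 : eLpNorm s 2 (P.scalar v) ^ 2 = ∫⁻ x, ‖s x‖ₑ ^ 2 ∂(P.scalar v) := by
      have := eLpNorm_nnreal_pow_eq_lintegral (f := s) (μ := P.scalar v) (p := 2) (by simp)
      simpa using this
    have h2 : ∫⁻ x, ‖s x‖ₑ ^ 2 ∂(P.scalar v)
        = ∫⁻ x, (s.map (fun y : ℂ => ‖y‖ₑ ^ 2)) x ∂(P.scalar v) := rfl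
    rw [h1, h2, SimpleFunc.lintegral_eq_lintegral, SimpleFunc.map_lintegral,
      ENNReal.ofReal_sum_of_nonneg (fun y _ => by positivity)]
    refine Finset.sum_congr rfl fun y _ => ?_
    rw [P.scalar_apply_norm v (s.measurableSet_preimage _), ENNReal.ofReal_mul (by positivity),
      ENNReal.ofReal_pow (norm_nonneg y), ofReal_norm]
  have hC : (eLpNorm s 2 (P.scalar v)).toReal ^ 2 = ‖P.simpleIntegral s v‖ ^ 2 := by
    rw [← ENNReal.toReal_pow, hB, hA, ENNReal.toReal_ofReal]
    exact Finset.sum_nonneg fun y _ => by positivity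
  exact ((sq_eq_sq₀ ENNReal.toReal_nonneg (norm_nonneg _)).1 hC).symm

/-- A sequence of simple functions that converges to `f` in `L²(P^v)` whenever `f ∈ L²(P^v)`. -/
def approx (f : ℝ → ℂ) (hf : Measurable f) (n : ℕ) : SimpleFunc ℝ ℂ :=
  SimpleFunc.approxOn f hf (range f ∪ {0}) 0 (by simp) n

theorem tendsto_approx {f : ℝ → ℂ} (hf : Measurable f) {v : H} (hv : MemLp f 2 (P.scalar v)) :
    Tendsto (fun n => P.simpleIntegral (approx f hf n) v) atTop
      (𝓝 (limUnder atTop fun n => P.simpleIntegral (approx f hf n) v)) := by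
  have : Fact ((1 : ℝ≥0∞) ≤ 2) := ⟨by norm_num⟩
  have hm := fun n => SimpleFunc.memLp_approxOn_range hf hv n
  have hL := (SimpleFunc.tendsto_approxOn_range_Lp (by simp) hf hv).cauchySeq
  have hC : CauchySeq (fun n => P.simpleIntegral (approx f hf n) v) := by
    rw [Metric.cauchySeq_iff] at hL ⊢
    intro ε hε
    obtain ⟨N, hN⟩ := hL ε hε
    refine ⟨N, fun m hm' n hn => ?_⟩
    have h := hN m hm' n hn
    rw [dist_eq_norm, ← MemLp.toLp_sub, Lp.norm_toLp] at h
    rw [dist_eq_norm, ← _root_.sub_apply, ← P.simpleIntegral_sub,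
      norm_simpleIntegral]
    exact h
  exact tendsto_nhds_limUnder (cauchySeq_tendsto_of_complete hC)

/-- The spectral integral `∫ f dP`: the (in general unbounded) operator with domain
`{v | ∫ |f|² dP^v < ∞}` that maps `v` to the limit of `∫ sₙ dP v`, where the simple functions `sₙ`
converge to `f` in `L²(P^v)`. For `A = ∫ p dP(p)`, this is the operator `f(A)`. -/
def integral (f : ℝ → ℂ) (hf : Measurable f) : H →ₗ.[ℂ] H where
  domain :=
    { carrier := {v | MemLp f 2 (P.scalar v)}
      zero_mem' := by
        change MemLp f 2 (P.scalar 0)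
        rw [P.scalar_zero]
        exact ⟨hf.aestronglyMeasurable, by simp⟩
      add_mem' := fun {v w} hv hw => by
        have h : MemLp f 2 (P.scalar v + P.scalar w) := by
          refine ⟨hf.aestronglyMeasurable, ?_⟩
          refine (eLpNorm_lt_top_iff_lintegral_rpow_enorm_lt_top (by simp) (by simp)).2 ?_
          rw [lintegral_add_measure]
          exact ENNReal.add_lt_top.2
            ⟨(eLpNorm_lt_top_iff_lintegral_rpow_enorm_lt_top (by simp) (by simp)).1 hv.2,
              (eLpNorm_lt_top_iff_lintegral_rpow_enorm_lt_top (by simp) (by simp)).1 hw.2⟩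
        exact (h.smul_measure (c := 2) (by simp)).mono_measure (P.scalar_add_le v w)
      smul_mem' := fun c v hv =>
        (MemLp.smul_measure hv ENNReal.ofReal_ne_top).mono_measure (P.scalar_smul_le c v) }
  toFun :=
    { toFun := fun v => limUnder atTop fun n => P.simpleIntegral (approx f hf n) (v : H)
      map_add' := fun v w => by
        refine tendsto_nhds_unique (P.tendsto_approx hf (v + w).2) ?_
        simpa only [Submodule.coe_add, map_add] using
          (P.tendsto_approx hf v.2).add (P.tendsto_approx hf w.2)
      map_smul' := fun c v => by
        refine tendsto_nhds_unique (P.tendsto_approx hf (c • v).2) ?_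
        simpa only [Submodule.coe_smul, map_smul, RingHom.id_apply] using
          (P.tendsto_approx hf v.2).const_smul c }

/-- The positive operator `e^{tA} = ∫ e^{tp} dP(p)`, where `A = ∫ p dP(p)`. -/
def expOp (t : ℝ) : H →ₗ.[ℂ] H :=
  P.integral (fun p => ((Real.exp (t * p) : ℝ) : ℂ)) (by fun_prop)

/-- The space `H^J_temp` of the vectors `v` fixed by `J` for which the measure `e^{πp} dP^v(p)` is
tempered, i.e. integrates `(1 + |p|)^{-n}` for some `n`. -/
def temperedVectors (J : H → H) : Set H :=
  {v | J v = v ∧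
    ((P.scalar v).withDensity fun p => ENNReal.ofReal (Real.exp (Real.pi * p))).HasTemperateGrowth}

end SpectralMeasure

/-! ### Unitary one-parameter groups, smooth vectors and distribution vectors -/

/-- A strongly continuous unitary one-parameter group `(U_t)_{t ∈ ℝ}`. -/
structure UnitaryOneParameterGroup (H : Type*) [NormedAddCommGroup H] [InnerProductSpace ℂ H] where
  /-- The unitary operator `U_t`. -/
  op : ℝ → H ≃ₗᵢ[ℂ] H
  op_zero : ∀ v, op 0 v = v
  op_add : ∀ s t v, op (s + t) v = op s (op t v)
  continuous_orbit : ∀ v, Continuous fun t => op t v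

/-- `P` is the spectral measure of `U`, i.e. `U_t = ∫ e^{itp} dP(p)` in the weak sense: all the
diagonal matrix coefficients satisfy `⟨v, U_t v⟩ = ∫ e^{itp} dP^v(p)`. -/
def SpectralMeasure.IsSpectralMeasureOf [CompleteSpace H] (P : SpectralMeasure H)
    (U : UnitaryOneParameterGroup H) : Prop :=
  ∀ (t : ℝ) (v : H),
    ⟪v, U.op t v⟫_ℂ = ∫ p, Complex.exp (Complex.I * t * p) ∂(P.scalar v)

namespace UnitaryOneParameterGroup

variable (U : UnitaryOneParameterGroup H)

/-- The subspace of the vectors with smooth orbit map. -/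
def smoothSubmodule : Submodule ℂ H where
  carrier := {v | ContDiff ℝ ∞ fun t => U.op t v}
  zero_mem' := by
    simp only [mem_ofPred_eq, map_zero]
    exact contDiff_const
  add_mem' := fun {v w} hv hw => by
    simp only [mem_ofPred_eq, map_add] at *
    exact hv.add hw
  smul_mem' := fun c v hv => by
    simp only [mem_ofPred_eq, map_smul] at *
    exact hv.const_smul c

/-- The space `H^∞` of smooth vectors. It is a copy of `smoothSubmodule` that does not inherit the
topology of `H`. -/
def SmoothVectors : Type _ := U.smoothSubmodule

instance : AddCommGroup U.SmoothVectors := inferInstanceAs (AddCommGroup U.smoothSubmodule)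

instance : Module ℂ U.SmoothVectors := inferInstanceAs (Module ℂ U.smoothSubmodule)

/-- The inclusion `H^∞ → H`. -/
def incl : U.SmoothVectors →ₗ[ℂ] H := U.smoothSubmodule.subtype

/-- The linear map `v ↦ (dⁿ/dtⁿ) U_t v |_{t = 0}`, i.e. `(iA)ⁿ` on `H^∞`. -/
def derivAtZero (n : ℕ) : U.SmoothVectors →ₗ[ℂ] H where
  toFun v := iteratedDeriv n (fun t => U.op t (U.incl v)) 0
  map_add' v w := by
    have hv : ContDiff ℝ ∞ fun t => U.op t (U.incl v) := v.2
    have hw : ContDiff ℝ ∞ fun t => U.op t (U.incl w) := w.2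
    simp only [map_add]
    exact iteratedDeriv_fun_add (hv.contDiffAt.of_le (by exact_mod_cast le_top))
      (hw.contDiffAt.of_le (by exact_mod_cast le_top))
  map_smul' c v := by
    simp only [map_smul, RingHom.id_apply]
    exact iteratedDeriv_fun_const_smul_field c _

/-- The seminorms `v ↦ ‖Aⁿ v‖` on `H^∞`. -/
def smoothSeminorms : SeminormFamily ℂ U.SmoothVectors ℕ :=
  fun n => (normSeminorm ℂ H).comp (U.derivAtZero n)

/-- The natural Fréchet topology on `H^∞`. -/
instance : TopologicalSpace U.SmoothVectors := U.smoothSeminorms.moduleFilterBasis.topology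

theorem withSeminorms : WithSeminorms U.smoothSeminorms := ⟨rfl⟩

instance : IsTopologicalAddGroup U.SmoothVectors := U.withSeminorms.topologicalAddGroup

instance : ContinuousSMul ℂ U.SmoothVectors := U.withSeminorms.continuousSMul

theorem continuous_incl : Continuous U.incl := by
  refine U.withSeminorms.continuous_of_isBounded (norm_withSeminorms ℂ H) U.incl ?_
  intro _
  refine ⟨{0}, 1, fun v => ?_⟩
  simp [smoothSeminorms, derivAtZero, U.op_zero]

/-- The space `H^{-∞}` of distribution vectors, i.e. of the continuous antilinear functionals on
`H^∞`, with the weak-* topology (the topology of pointwise convergence on `H^∞`). -/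
abbrev DistributionVectors : Type _ :=
  PointwiseConvergenceCLM (starRingEnd ℂ) U.SmoothVectors ℂ

/-- The linear embedding `H → H^{-∞}`, `v ↦ ⟨·, v⟩`. -/
def toDistribution (v : H) : U.DistributionVectors :=
  ({ toFun := fun φ => ⟪U.incl φ, v⟫_ℂ
     map_add' := fun φ ψ => by rw [map_add, inner_add_left]
     map_smul' := fun c φ => by rw [map_smul, inner_smul_left, smul_eq_mul]
     cont := U.continuous_incl.inner continuous_const } : U.SmoothVectors →SL[starRingEnd ℂ] ℂ)

end UnitaryOneParameterGroup

end

/-!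
The proof takes place in the spectral representation: `f ↦ ∫ f dP v` is an isometry `V` from
`L²(P^v)` into `H` (`SpectralMeasure.lpIsometry`), under which `U_t` is multiplication by `e^{itp}`
(`SpectralMeasure.op_vec`) and `e^{tA} v` is the image of `e^{tp}`. Since `v` is fixed by `J`, which
commutes with `U`, the Fourier transform `⟨v, U_t v⟩` of `P^v` is real and `P^v` is symmetric
(`SpectralMeasure.map_neg_scalar`). Temperedness of `e^{πp} dP^v` is therefore the same as
temperedness of `e^{π|p|} dP^v`, in which both ends of the strip `|t| < π/2` enter alike.

*Temperedness and growth.* As `‖e^{tA} v‖² = ∫ e^{2tp} dP^v`, this is an equivalence for symmetric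
measures. In one direction, `(1 + |p|)ⁿ e^{-2δ|p|} = O(δ⁻ⁿ)` for `δ = π/2 - |t|`
(`HasTemperedExpMoment.exists_bound`). In the other direction, the bound at `t = π/2 - 1/(k + 1)`
controls the shell `k ≤ |p| < k + 1`, and the bounds for the shells are summed
(`hasTemperedExpMoment_of_bound`).

*Temperedness gives boundary values.* Write `e^{-tA} v = (1 - iA)^m w_t` with
`w_t = V((1 - ip)^{-m} e^{-tp})`. For large `m`, `w_t` converges in norm as `t → ±π/2` by dominated
convergence. The pairing of `(1 - iA)^m w_t` with a smooth vector `φ` is `⟨(1 + iA)^m φ, w_t⟩`,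
a combination of the `⟨(iA)ᵏ φ, w_t⟩`, so the limit is a continuous functional
(`HasTemperedExpMoment.exists_boundaryValue`). Here `(iA)ᵏ φ` is a derivative of the orbit of `φ`,
and it suffices to move these derivatives to the other side (`inner_derivAtZero_vec`); the spectral
measure of `φ` is not needed.

*Boundary values give temperedness.* The functional `β^+(v)` is continuous, hence bounded by
finitely many of the seminorms `‖Aⁿ φ‖`, `n ≤ m`. It is tested on
`φ_R = V(1_{|p| ≤ R} (1 + p²)^{-m} e^{-πp/2})`. With `I_R = ∫_{|p| ≤ R} (1 + p²)^{-m} e^{-πp} dP^v`,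
the pairing is `I_R` while the seminorms are at most `√I_R`. So `I_R ≤ K √I_R`, and `I_R` stays
bounded as `R → ∞` (`hasTemperedExpMoment_of_tendsto`).
-/

/-! ### Spectral integrals of a fixed vector as an isometry on `L²(P^v)` -/

namespace SpectralMeasure

variable {H : Type*} [NormedAddCommGroup H] [InnerProductSpace ℂ H] [CompleteSpace H]
  (P : SpectralMeasure H)

theorem proj_simpleIntegral (s : SimpleFunc ℝ ℂ) {E : Set ℝ} (hE : MeasurableSet E) (v : H) :
    P.proj E (P.simpleIntegral s v) = P.simpleIntegral s (P.proj E v) := by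
  simp only [simpleIntegral, _root_.sum_apply, map_sum, _root_.smul_apply, map_smul]
  refine Finset.sum_congr rfl fun y _ => ?_
  rw [← mul_apply_eq_comp, ← mul_apply_eq_comp,
    ← P.proj_inter _ _ hE (s.measurableSet_preimage _),
    ← P.proj_inter _ _ (s.measurableSet_preimage _) hE, inter_comm]

theorem scalar_proj {E : Set ℝ} (hE : MeasurableSet E) (v : H) :
    P.scalar (P.proj E v) = (P.scalar v).restrict E := by
  ext F hF
  rw [Measure.restrict_apply hF, P.scalar_apply_norm _ hF, P.scalar_apply_norm _ (hF.inter hE),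
    P.proj_inter F E hF hE, mul_apply_eq_comp]

/-- The integral may be computed with any sequence of simple functions that converges in
`L²(P^v)`. -/
theorem tendsto_simpleIntegral {f : ℝ → ℂ} (hf : Measurable f) {v : H}
    (hv : MemLp f 2 (P.scalar v)) {s : ℕ → SimpleFunc ℝ ℂ}
    (hs : Tendsto (fun n => eLpNorm (⇑(s n) - f) 2 (P.scalar v)) atTop (𝓝 0)) :
    Tendsto (fun n => P.simpleIntegral (s n) v) atTop (𝓝 (P.integral f hf ⟨v, hv⟩)) := by
  have h1 : Tendsto (fun n => eLpNorm (⇑(approx f hf n) - f) 2 (P.scalar v)) atTop (𝓝 0) :=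
    SimpleFunc.tendsto_approxOn_range_Lp_eLpNorm (by simp) hf hv.2
  have h2 : Tendsto (fun n => eLpNorm (⇑(s n) - ⇑(approx f hf n)) 2 (P.scalar v)) atTop (𝓝 0) := by
    have h3 := hs.add h1
    rw [add_zero] at h3
    refine tendsto_of_tendsto_of_tendsto_of_le_of_le tendsto_const_nhds h3 (fun _ => zero_le)
      fun n => ?_
    have : ⇑(s n) - ⇑(approx f hf n) = (⇑(s n) - f) - (⇑(approx f hf n) - f) := by abel
    rw [this]
    exact eLpNorm_sub_le ((s n).measurable.sub hf).aestronglyMeasurable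
      ((approx f hf n).measurable.sub hf).aestronglyMeasurable (by norm_num)
  have h4 : Tendsto (fun n => P.simpleIntegral (s n) v - P.simpleIntegral (approx f hf n) v)
      atTop (𝓝 0) := by
    rw [tendsto_zero_iff_norm_tendsto_zero]
    have := (ENNReal.tendsto_toReal (by simp)).comp h2
    simp only [ENNReal.toReal_zero] at this
    refine this.congr fun n => ?_
    rw [← _root_.sub_apply, ← P.simpleIntegral_sub, norm_simpleIntegral]
    rfl
  have h5 := h4.add (P.tendsto_approx hf hv)
  simp only [sub_add_cancel, zero_add] at h5
  exact h5

/-- The norm of `P(E) ∫ f dP v` is the `L²`-norm of `f` on `E`. It holds for simple functions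
because `P(E)` commutes with their integrals and `P^{P(E)v}` is the restriction of `P^v` to `E`. -/
theorem norm_proj_integral {f : ℝ → ℂ} (hf : Measurable f) {v : H}
    (hv : MemLp f 2 (P.scalar v)) {E : Set ℝ} (hE : MeasurableSet E) :
    ‖P.proj E (P.integral f hf ⟨v, hv⟩)‖
      = (eLpNorm f 2 ((P.scalar v).restrict E)).toReal := by
  have : Fact ((1 : ℝ≥0∞) ≤ 2) := ⟨by norm_num⟩
  have hE' := hv.restrict E
  have h1 := (((P.proj E).continuous.tendsto _).comp (P.tendsto_approx hf hv)).norm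
  have h2 := (SimpleFunc.tendsto_approxOn_range_Lp (by simp) hf hE').norm
  simp only [Lp.norm_toLp] at h2
  refine tendsto_nhds_unique h1 (h2.congr fun n => ?_)
  rw [Function.comp_apply, P.proj_simpleIntegral _ hE, norm_simpleIntegral, P.scalar_proj hE]
  rfl

/-- The isometry `L²(P^v) → H`, `f ↦ ∫ f dP v`. -/
noncomputable def lpIsometry (v : H) : Lp ℂ 2 (P.scalar v) →ₗᵢ[ℂ] H where
  toFun f := P.integral f (Lp.stronglyMeasurable f).measurable ⟨v, Lp.memLp f⟩
  -- Additivity is derived from subtractivity, which is available for simple functions.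
  map_add' := by
    have hsub : ∀ f g : Lp ℂ 2 (P.scalar v),
        P.integral (f - g : Lp ℂ 2 (P.scalar v))
            (Lp.stronglyMeasurable _).measurable ⟨v, Lp.memLp _⟩
          = P.integral f (Lp.stronglyMeasurable f).measurable ⟨v, Lp.memLp f⟩
            - P.integral g (Lp.stronglyMeasurable g).measurable ⟨v, Lp.memLp g⟩ := by
      intro f g
      have hf := (Lp.stronglyMeasurable f).measurable
      have hg := (Lp.stronglyMeasurable g).measurable
      have h1 := SimpleFunc.tendsto_approxOn_range_Lp_eLpNorm (by simp) hf (Lp.memLp f).2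
      have h2 := SimpleFunc.tendsto_approxOn_range_Lp_eLpNorm (by simp) hg (Lp.memLp g).2
      have h3 := h1.add h2
      rw [add_zero] at h3
      refine tendsto_nhds_unique (P.tendsto_simpleIntegral
        (s := fun n => approx f hf n - approx g hg n)
        (Lp.stronglyMeasurable (f - g)).measurable (Lp.memLp (f - g)) ?_) ?_
      · refine tendsto_of_tendsto_of_tendsto_of_le_of_le tendsto_const_nhds h3 (fun _ => zero_le)
          fun n => ?_
        have : (⇑(approx f hf n - approx g hg n) - ⇑(f - g) : ℝ → ℂ)
            =ᵐ[P.scalar v] (⇑(approx f hf n) - ⇑f) - (⇑(approx g hg n) - ⇑g) := by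
          filter_upwards [Lp.coeFn_sub f g] with x hx
          simp only [Pi.sub_apply, hx, SimpleFunc.coe_sub]
          ring
        rw [eLpNorm_congr_ae this]
        exact eLpNorm_sub_le ((approx f hf n).measurable.sub hf).aestronglyMeasurable
          ((approx g hg n).measurable.sub hg).aestronglyMeasurable (by norm_num)
      · simp only [simpleIntegral_sub, _root_.sub_apply]
        exact (P.tendsto_approx hf (Lp.memLp f)).sub (P.tendsto_approx hg (Lp.memLp g))
    intro f g
    have h := hsub (f + g) g
    have hcongr : ∀ a b : Lp ℂ 2 (P.scalar v), a = b →
        P.integral a (Lp.stronglyMeasurable a).measurable ⟨v, Lp.memLp a⟩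
          = P.integral b (Lp.stronglyMeasurable b).measurable ⟨v, Lp.memLp b⟩ := by
      rintro a _ rfl
      rfl
    rw [hcongr _ _ (add_sub_cancel_right f g), eq_sub_iff_add_eq] at h
    exact h.symm
  map_smul' := by
    intro c f
    have hf := (Lp.stronglyMeasurable f).measurable
    have h1 := SimpleFunc.tendsto_approxOn_range_Lp_eLpNorm (by simp) hf (Lp.memLp f).2
    have h3 := ENNReal.Tendsto.const_mul (a := ‖c‖ₑ) h1 (Or.inr enorm_ne_top)
    rw [mul_zero] at h3
    refine tendsto_nhds_unique (P.tendsto_simpleIntegral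
      (s := fun n => (approx f hf n).map fun z => c * z)
      (Lp.stronglyMeasurable (c • f)).measurable (Lp.memLp (c • f)) ?_) ?_
    · refine h3.congr fun n => ?_
      rw [← eLpNorm_const_smul]
      refine (eLpNorm_congr_ae ?_).symm
      filter_upwards [Lp.coeFn_smul c f] with x hx
      simp only [Pi.sub_apply, hx, Pi.smul_apply, SimpleFunc.coe_map, Function.comp_apply,
        smul_eq_mul, mul_sub]
      rfl
    · refine ((P.tendsto_approx hf (Lp.memLp f)).const_smul c).congr fun n => ?_
      rw [simpleIntegral_map]
      simp [simpleIntegral, Finset.smul_sum, mul_smul]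
  norm_map' f := by
    have h := P.norm_proj_integral (Lp.stronglyMeasurable f).measurable (Lp.memLp f)
      MeasurableSet.univ
    rw [P.proj_univ, Measure.restrict_univ] at h
    exact h

theorem lpIsometry_toLp {f : ℝ → ℂ} (hf : Measurable f) {v : H} (hv : MemLp f 2 (P.scalar v)) :
    P.lpIsometry v (hv.toLp f) = P.integral f hf ⟨v, hv⟩ := by
  have h1 := SimpleFunc.tendsto_approxOn_range_Lp_eLpNorm (by simp) hf hv.2
  refine tendsto_nhds_unique (P.tendsto_simpleIntegral (s := approx f hf)
    (Lp.stronglyMeasurable (hv.toLp f)).measurable (Lp.memLp (hv.toLp f)) ?_)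
    (P.tendsto_approx hf hv)
  refine h1.congr fun n => eLpNorm_congr_ae ?_
  filter_upwards [hv.coeFn_toLp] with x hx
  simp only [Pi.sub_apply, hx]
  rfl

/-- The vector `∫ f dP v = f(A) v`, with the junk value `0` if `f` is not square integrable with
respect to `P^v`. Totalizing `f ↦ P.integral f _ ⟨v, _⟩` avoids dependent arguments. -/
noncomputable def vec (v : H) (f : ℝ → ℂ) : H :=
  open Classical in if h : MemLp f 2 (P.scalar v) then P.lpIsometry v (h.toLp f) else 0

variable {P} {v : H} {f g : ℝ → ℂ}

theorem vec_eq_toLp (h : MemLp f 2 (P.scalar v)) : P.vec v f = P.lpIsometry v (h.toLp f) :=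
  dif_pos h

theorem integral_eq_vec (hf : Measurable f) (h : MemLp f 2 (P.scalar v)) :
    P.integral f hf ⟨v, h⟩ = P.vec v f := by
  rw [vec_eq_toLp h, lpIsometry_toLp]

theorem vec_add (hf : MemLp f 2 (P.scalar v)) (hg : MemLp g 2 (P.scalar v)) :
    P.vec v (f + g) = P.vec v f + P.vec v g := by
  rw [vec_eq_toLp hf, vec_eq_toLp hg, vec_eq_toLp (hf.add hg), MemLp.toLp_add hf hg, map_add]

theorem vec_sub (hf : MemLp f 2 (P.scalar v)) (hg : MemLp g 2 (P.scalar v)) :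
    P.vec v (f - g) = P.vec v f - P.vec v g := by
  rw [vec_eq_toLp hf, vec_eq_toLp hg, vec_eq_toLp (hf.sub hg), MemLp.toLp_sub hf hg, map_sub]

theorem vec_smul (c : ℂ) (hf : MemLp f 2 (P.scalar v)) :
    P.vec v (c • f) = c • P.vec v f := by
  rw [vec_eq_toLp hf, vec_eq_toLp (hf.const_smul c), MemLp.toLp_const_smul, map_smul]

theorem vec_const_mul (c : ℂ) (hf : MemLp f 2 (P.scalar v)) :
    P.vec v (fun p => c * f p) = c • P.vec v f :=
  vec_smul c hf

theorem vec_sum {ι : Type*} (s : Finset ι) (F : ι → ℝ → ℂ)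
    (hF : ∀ i ∈ s, MemLp (F i) 2 (P.scalar v)) :
    P.vec v (fun p => ∑ i ∈ s, F i p) = ∑ i ∈ s, P.vec v (F i) := by
  classical
  induction s using Finset.induction_on with
  | empty =>
    have h0 : MemLp (0 : ℝ → ℂ) 2 (P.scalar v) := MemLp.zero
    have h := vec_smul 0 h0
    rw [zero_smul, zero_smul] at h
    simp only [Finset.sum_empty]
    exact h
  | insert a s ha ih =>
    simp only [Finset.sum_insert ha]
    rw [← ih fun i hi => hF i (Finset.mem_insert_of_mem hi)]
    exact vec_add (hF a (Finset.mem_insert_self a s))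
      (memLp_finsetSum s fun i hi => hF i (Finset.mem_insert_of_mem hi))

theorem norm_vec (hf : MemLp f 2 (P.scalar v)) :
    ‖P.vec v f‖ = (eLpNorm f 2 (P.scalar v)).toReal := by
  rw [vec_eq_toLp hf, LinearIsometry.norm_map, Lp.norm_toLp]

theorem inner_vec (hf : MemLp f 2 (P.scalar v)) (hg : MemLp g 2 (P.scalar v)) :
    ⟪P.vec v f, P.vec v g⟫_ℂ = ∫ p, g p * (starRingEnd ℂ) (f p) ∂(P.scalar v) := by
  rw [vec_eq_toLp hf, vec_eq_toLp hg, LinearIsometry.inner_map_map, L2.inner_def]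
  refine integral_congr_ae ?_
  filter_upwards [hf.coeFn_toLp, hg.coeFn_toLp] with x hx hy
  rw [hx, hy]
  rfl

theorem enorm_vec_sq (hf : MemLp f 2 (P.scalar v)) :
    ENNReal.ofReal (‖P.vec v f‖ ^ 2) = ∫⁻ p, ‖f p‖ₑ ^ 2 ∂(P.scalar v) := by
  have := eLpNorm_nnreal_pow_eq_lintegral (f := f) (μ := P.scalar v) (p := 2) (by simp)
  rw [norm_vec hf, ← ENNReal.toReal_pow, ENNReal.ofReal_toReal (by simp [hf.2.ne])]
  simpa using this

/-- The spectral measure of `∫ f dP v` has density `|f|²` with respect to that of `v`. -/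
theorem scalar_lpIsometry (F : Lp ℂ 2 (P.scalar v)) :
    P.scalar (P.lpIsometry v F) = (P.scalar v).withDensity fun p => ‖F p‖ₑ ^ 2 := by
  ext E hE
  have h := P.norm_proj_integral (Lp.stronglyMeasurable F).measurable (Lp.memLp F) hE
  have := eLpNorm_nnreal_pow_eq_lintegral (f := F) (μ := (P.scalar v).restrict E) (p := 2)
    (by simp)
  have h2 := ((Lp.memLp F).restrict E).2.ne
  rw [scalar_apply_norm _ _ hE, withDensity_apply _ hE]
  change ENNReal.ofReal (‖P.proj E (P.integral F _ ⟨v, _⟩)‖ ^ 2) = _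
  rw [h, ← ENNReal.toReal_pow, ENNReal.ofReal_toReal (by simp [h2])]
  simpa using this

end SpectralMeasure

/-! ### The unitary group and its smooth vectors in the spectral representation -/

namespace SpectralMeasure

variable {H : Type*} [NormedAddCommGroup H] [InnerProductSpace ℂ H] [CompleteSpace H]
  {P : SpectralMeasure H} {U : UnitaryOneParameterGroup H} {v : H} {f g : ℝ → ℂ}

theorem norm_exp_I_mul (t p : ℝ) : ‖Complex.exp (Complex.I * t * p)‖ = 1 := by
  have : Complex.I * t * p = ((t * p : ℝ) : ℂ) * Complex.I := by push_cast; ring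
  rw [this, Complex.norm_exp_ofReal_mul_I]

theorem memLp_exp_mul {μ : Measure ℝ} (t : ℝ) (hf : MemLp f 2 μ) :
    MemLp (fun p : ℝ => Complex.exp (Complex.I * t * p) * f p) 2 μ := by
  refine hf.of_le (AEStronglyMeasurable.mul ?_ hf.1) (ae_of_all _ fun p => ?_)
  · exact (by fun_prop : Measurable fun p : ℝ =>
      Complex.exp (Complex.I * t * p)).aestronglyMeasurable
  · rw [norm_mul, norm_exp_I_mul, one_mul]

/-- Multiplication by `e^{itp}` on `L²(μ)`. -/
noncomputable def expMul (μ : Measure ℝ) (t : ℝ) : Lp ℂ 2 μ →ₗ[ℂ] Lp ℂ 2 μ where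
  toFun F := (memLp_exp_mul t (Lp.memLp F)).toLp _
  map_add' F G := by
    rw [← MemLp.toLp_add]
    refine MemLp.toLp_congr _ _ ?_
    filter_upwards [Lp.coeFn_add F G] with p hp
    simp only [hp, Pi.add_apply, mul_add]
  map_smul' c F := by
    rw [RingHom.id_apply, ← MemLp.toLp_const_smul]
    refine MemLp.toLp_congr _ _ ?_
    filter_upwards [Lp.coeFn_smul c F] with p hp
    simp only [hp, Pi.smul_apply, smul_eq_mul]
    ring

theorem norm_expMul (μ : Measure ℝ) (t : ℝ) (F : Lp ℂ 2 μ) : ‖expMul μ t F‖ = ‖F‖ := by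
  rw [expMul, LinearMap.coe_mk, AddHom.coe_mk, Lp.norm_toLp, Lp.norm_def]
  congr 1
  refine eLpNorm_congr_norm_ae (ae_of_all _ fun p => ?_)
  rw [norm_mul, norm_exp_I_mul, one_mul]

/-- The diagonal matrix coefficients of `U_t` in the spectral representation, because `P^{Vf}` has
density `|f|²` with respect to `P^v`, where `V` is `P.lpIsometry v`. -/
theorem inner_lpIsometry_op (F : Lp ℂ 2 (P.scalar v)) (t : ℝ)
    (hP : P.IsSpectralMeasureOf U) :
    ⟪P.lpIsometry v F, U.op t (P.lpIsometry v F)⟫_ℂ = ⟪F, expMul (P.scalar v) t F⟫_ℂ := by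
  have hF := (Lp.stronglyMeasurable F).measurable
  rw [hP, scalar_lpIsometry, integral_withDensity_eq_integral_toReal_smul (by fun_prop)
    (ae_of_all _ fun p => by simp), L2.inner_def]
  refine integral_congr_ae ?_
  filter_upwards [(memLp_exp_mul t (Lp.memLp F)).coeFn_toLp] with p hp
  rw [expMul, LinearMap.coe_mk, AddHom.coe_mk, hp, RCLike.inner_apply,
    mul_assoc (Complex.exp _), RCLike.mul_conj, ENNReal.toReal_pow, toReal_enorm,
    Complex.real_smul, mul_comm]
  norm_cast

/-- In the spectral representation, `U_t` acts as multiplication by `e^{itp}`. By hypothesis the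
two operators have the same diagonal matrix coefficients on `L²(P^v)`, hence agree after
compression to `L²(P^v)`; as both are isometric, they agree. -/
theorem op_lpIsometry (hP : P.IsSpectralMeasureOf U) (t : ℝ) (F : Lp ℂ 2 (P.scalar v)) :
    U.op t (P.lpIsometry v F) = P.lpIsometry v (expMul (P.scalar v) t F) := by
  let V := (P.lpIsometry v).toContinuousLinearMap
  let S : Lp ℂ 2 (P.scalar v) →ₗ[ℂ] Lp ℂ 2 (P.scalar v) :=
    (ContinuousLinearMap.adjoint V).toLinearMap ∘ₗ
      (U.op t).toLinearEquiv.toLinearMap ∘ₗ V.toLinearMap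
  have hS : S = expMul (P.scalar v) t := by
    refine (ext_inner_map S _).1 fun x => ?_
    rw [← inner_conj_symm, ← inner_conj_symm (expMul _ t x)]
    congr 1
    rw [← inner_lpIsometry_op x t hP]
    exact ContinuousLinearMap.adjoint_inner_right V x _
  have hin : ⟪P.lpIsometry v (expMul (P.scalar v) t F), U.op t (P.lpIsometry v F)⟫_ℂ
      = ⟪expMul (P.scalar v) t F, expMul (P.scalar v) t F⟫_ℂ := by
    have h1 := ContinuousLinearMap.adjoint_inner_right V (expMul (P.scalar v) t F)
      (U.op t (P.lpIsometry v F))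
    have h2 : ContinuousLinearMap.adjoint V (U.op t (P.lpIsometry v F))
        = expMul (P.scalar v) t F := congrArg (fun T => T F) hS
    rw [h2] at h1
    exact h1.symm
  rw [← sub_eq_zero, ← norm_eq_zero, ← sq_eq_zero_iff, @norm_sub_sq ℂ, ← inner_conj_symm, hin,
    LinearIsometryEquiv.norm_map, LinearIsometry.norm_map, LinearIsometry.norm_map,
    inner_self_eq_norm_sq_to_K, norm_expMul]
  simp only [map_pow, Complex.conj_ofReal, RCLike.re_to_complex, Complex.coe_algebraMap]
  norm_cast
  ring

theorem op_vec (hP : P.IsSpectralMeasureOf U) (t : ℝ) (hf : MemLp f 2 (P.scalar v)) :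
    U.op t (P.vec v f) = P.vec v fun p => Complex.exp (Complex.I * t * p) * f p := by
  rw [vec_eq_toLp hf, op_lpIsometry hP, vec_eq_toLp (memLp_exp_mul t hf), expMul,
    LinearMap.coe_mk, AddHom.coe_mk]
  congr 1
  refine MemLp.toLp_congr _ _ ?_
  filter_upwards [hf.coeFn_toLp] with p hp
  rw [hp]

theorem norm_exp_I_mul_sub_one_sub_le (x : ℝ) :
    ‖Complex.exp (Complex.I * x) - 1 - Complex.I * x‖ ≤ 2 * x ^ 2 := by
  have hx : ‖Complex.I * x‖ = |x| := by simp
  rcases le_total |x| 1 with h | h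
  · have := Complex.norm_exp_sub_one_sub_id_le (hx.trans_le h)
    rw [hx, sq_abs] at this
    nlinarith [sq_nonneg x]
  · have h1 := norm_sub_le (Complex.exp (Complex.I * x) - 1) (Complex.I * x)
    have h2 := Real.norm_exp_I_mul_ofReal_sub_one_le (x := x)
    rw [hx] at h1
    rw [Real.norm_eq_abs] at h2
    nlinarith [sq_abs x]

/-- The orbit maps of `U` are differentiated under the spectral integral. -/
theorem hasDerivAt_op_vec (hP : P.IsSpectralMeasureOf U) (hf : MemLp f 2 (P.scalar v))
    (h1 : MemLp (fun p : ℝ => Complex.I * p * f p) 2 (P.scalar v))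
    (h2 : MemLp (fun p : ℝ => (Complex.I * p) ^ 2 * f p) 2 (P.scalar v)) (t : ℝ) :
    HasDerivAt (fun s => U.op s (P.vec v f))
      (U.op t (P.vec v fun p : ℝ => Complex.I * p * f p)) t := by
  set w := P.vec v f
  set w' := P.vec v fun p : ℝ => Complex.I * p * f p
  set C := 2 * ‖P.vec v fun p : ℝ => (Complex.I * p) ^ 2 * f p‖
  have key : ∀ h : ℝ, ‖U.op h w - w - h • w'‖ ≤ C * h ^ 2 := by
    intro h
    have e1 : U.op h w - w - h • w' = P.vec v fun p =>
        (Complex.exp (Complex.I * (h * p : ℝ)) - 1 - Complex.I * (h * p : ℝ)) * f p := by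
      have hexp := memLp_exp_mul h hf
      have e2 : h • w' = (h : ℂ) • w' := (Complex.coe_smul h w').symm
      rw [e2, op_vec hP h hf, ← vec_smul _ h1, ← vec_sub hexp hf,
        ← vec_sub (hexp.sub hf) (h1.const_smul _)]
      congr 1
      ext p
      simp only [Pi.sub_apply, Pi.smul_apply, smul_eq_mul]
      push_cast
      ring_nf
    have hle : ∀ p : ℝ,
        ‖(Complex.exp (Complex.I * (h * p : ℝ)) - 1 - Complex.I * (h * p : ℝ)) * f p‖
          ≤ ‖((2 * h ^ 2 : ℝ) : ℂ) * ((Complex.I * p) ^ 2 * f p)‖ := by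
      intro p
      rw [norm_mul, norm_mul, norm_mul, ← mul_assoc]
      refine mul_le_mul_of_nonneg_right ?_ (norm_nonneg _)
      refine (norm_exp_I_mul_sub_one_sub_le (h * p)).trans_eq ?_
      rw [norm_pow, norm_mul, Complex.norm_I, Complex.norm_real, Complex.norm_real,
        Real.norm_eq_abs, Real.norm_eq_abs, one_mul, sq_abs, abs_of_nonneg (by positivity)]
      ring
    have hm2 := h2.const_mul ((2 * h ^ 2 : ℝ) : ℂ)
    have hm : MemLp (fun p : ℝ =>
        (Complex.exp (Complex.I * (h * p : ℝ)) - 1 - Complex.I * (h * p : ℝ)) * f p)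
        2 (P.scalar v) := by
      refine hm2.of_le (AEStronglyMeasurable.mul ?_ hf.1) (ae_of_all _ hle)
      exact (by fun_prop : Measurable fun p : ℝ => Complex.exp (Complex.I * (h * p : ℝ)) - 1
        - Complex.I * (h * p : ℝ)).aestronglyMeasurable
    have e3 : C * h ^ 2 = ‖P.vec v fun p : ℝ =>
        ((2 * h ^ 2 : ℝ) : ℂ) * ((Complex.I * p) ^ 2 * f p)‖ := by
      rw [vec_const_mul _ h2, norm_smul, Complex.norm_real, Real.norm_eq_abs,
        abs_of_nonneg (by positivity)]
      ring
    rw [e1, e3, norm_vec hm, norm_vec hm2]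
    exact ENNReal.toReal_mono hm2.2.ne (eLpNorm_mono hle)
  have hO : HasFDerivAt (fun s : ℝ => U.op s w - U.op t w - (s - t) • U.op t w')
      (0 : ℝ →L[ℝ] H) t := by
    refine Asymptotics.IsBigO.hasFDerivAt (n := 2) ?_ (by norm_num)
    refine Asymptotics.IsBigO.of_bound C (Eventually.of_forall fun s => ?_)
    have : U.op s w - U.op t w - (s - t) • U.op t w' = U.op t (U.op (s - t) w - w
        - (s - t) • w') := by
      have e4 : U.op t ((s - t) • w') = (s - t) • U.op t w' := by
        rw [← Complex.coe_smul, map_smul, Complex.coe_smul]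
      rw [map_sub, map_sub, ← U.op_add, add_sub_cancel, e4]
    rw [this, LinearIsometryEquiv.norm_map, Real.norm_eq_abs, Real.norm_eq_abs, sq_abs,
      abs_of_nonneg (sq_nonneg _)]
    exact key _
  have h3 := hO.hasDerivAt.add
    ((((hasDerivAt_id t).sub_const t).smul_const (U.op t w')).add_const (U.op t w))
  refine (h3.congr_deriv ?_).congr_of_eventuallyEq (Eventually.of_forall fun s => ?_)
  · simp
  · simp only [Pi.add_apply, id]
    abel

/-- All derivatives of the orbit of `∫ f dP v`, where all moments `pⁿ f` are square
integrable. -/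
theorem iteratedDeriv_op_vec (hP : P.IsSpectralMeasureOf U)
    (hf : ∀ n : ℕ, MemLp (fun p : ℝ => (Complex.I * p) ^ n * f p) 2 (P.scalar v)) (n : ℕ) :
    iteratedDeriv n (fun s => U.op s (P.vec v f))
      = fun t => U.op t (P.vec v fun p : ℝ => (Complex.I * p) ^ n * f p) := by
  induction n with
  | zero => simp
  | succ n ih =>
    rw [iteratedDeriv_succ, ih]
    funext t
    have e1 : (fun p : ℝ => (Complex.I * p) * ((Complex.I * p) ^ n * f p))
        = fun p : ℝ => (Complex.I * p) ^ (n + 1) * f p := by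
      ext p; ring
    have e2 : (fun p : ℝ => (Complex.I * p) ^ 2 * ((Complex.I * p) ^ n * f p))
        = fun p : ℝ => (Complex.I * p) ^ (n + 2) * f p := by
      ext p; ring
    have := hasDerivAt_op_vec hP (hf n) (by rw [e1]; exact hf _) (by rw [e2]; exact hf _) t
    rw [this.deriv, e1]

theorem vec_mem_smoothSubmodule (hP : P.IsSpectralMeasureOf U)
    (hf : ∀ n : ℕ, MemLp (fun p : ℝ => (Complex.I * p) ^ n * f p) 2 (P.scalar v)) :
    P.vec v f ∈ U.smoothSubmodule := by
  refine contDiff_of_differentiable_iteratedDeriv fun n _ => ?_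
  have h := iteratedDeriv_op_vec hP hf
  intro t
  by_contra hd
  rw [h] at hd
  have e1 : (fun p : ℝ => (Complex.I * p) * ((Complex.I * p) ^ n * f p))
      = fun p : ℝ => (Complex.I * p) ^ (n + 1) * f p := by
    ext p; ring
  have e2 : (fun p : ℝ => (Complex.I * p) ^ 2 * ((Complex.I * p) ^ n * f p))
      = fun p : ℝ => (Complex.I * p) ^ (n + 2) * f p := by
    ext p; ring
  exact hd (hasDerivAt_op_vec hP (hf n) (by rw [e1]; exact hf _)
    (by rw [e2]; exact hf _) t).differentiableAt

/-- Integration by parts: the operator `(iA)ⁿ` on smooth vectors is moved to the spectral side of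
the pairing. It holds because `⟨U_s φ, ∫ f dP v⟩ = ⟨φ, U_{-s} ∫ f dP v⟩` for all `s`. -/
theorem inner_derivAtZero_vec (hP : P.IsSpectralMeasureOf U) (φ : U.SmoothVectors)
    (hf : ∀ n : ℕ, MemLp (fun p : ℝ => (-(Complex.I * p)) ^ n * f p) 2 (P.scalar v)) (n : ℕ) :
    ⟪U.derivAtZero n φ, P.vec v f⟫_ℂ
      = ⟪U.incl φ, P.vec v fun p : ℝ => (-(Complex.I * p)) ^ n * f p⟫_ℂ := by
  have hadj : ∀ (s : ℝ) (x y : H), ⟪U.op s x, y⟫_ℂ = ⟪x, U.op (-s) y⟫_ℂ := by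
    intro s x y
    rw [← (U.op (-s)).inner_map_map, ← U.op_add, neg_add_cancel, U.op_zero]
  have hφ : ContDiff ℝ ∞ fun t => U.op t (U.incl φ) := φ.2
  have main : ∀ n : ℕ, ∀ s : ℝ, ⟪iteratedDeriv n (fun t => U.op t (U.incl φ)) s, P.vec v f⟫_ℂ
      = ⟪U.op s (U.incl φ), P.vec v fun p : ℝ => (-(Complex.I * p)) ^ n * f p⟫_ℂ := by
    intro n
    induction n with
    | zero => simp
    | succ n ih =>
      intro s
      have hd : HasDerivAt (iteratedDeriv n fun t => U.op t (U.incl φ))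
          (iteratedDeriv (n + 1) (fun t => U.op t (U.incl φ)) s) s := by
        rw [iteratedDeriv_succ]
        exact (hφ.differentiable_iteratedDeriv n (by exact_mod_cast WithTop.coe_lt_top n)
          s).hasDerivAt
      have h1 := hd.inner ℂ (hasDerivAt_const s (P.vec v f))
      simp only [inner_zero_right, zero_add] at h1
      set g : ℝ → ℂ := fun p => (-(Complex.I * p)) ^ n * f p with hg
      have e1 : (fun p : ℝ => Complex.I * p * g p)
          = -fun p : ℝ => (-(Complex.I * p)) ^ (n + 1) * f p := by
        ext p; simp only [Pi.neg_apply, hg]; ring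
      have e2 : (fun p : ℝ => (Complex.I * p) ^ 2 * g p)
          = fun p : ℝ => (-(Complex.I * p)) ^ (n + 2) * f p := by
        ext p; simp only [hg]; ring
      have h2 := hasDerivAt_op_vec hP (hf n) (by rw [e1]; exact (hf _).neg)
        (by rw [e2]; exact hf _) (-s)
      have h3 := (hasDerivAt_const s (U.incl φ)).inner ℂ
        (h2.scomp s (hasDerivAt_neg s))
      simp only [inner_zero_left, add_zero, Function.comp_def] at h3
      have h4 : (fun s => ⟪iteratedDeriv n (fun t => U.op t (U.incl φ)) s, P.vec v f⟫_ℂ)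
          = fun s => ⟪U.incl φ, U.op (-s) (P.vec v g)⟫_ℂ := by
        funext s
        rw [ih s, hadj]
      rw [h4] at h1
      rw [h1.unique h3, hadj, e1]
      have h5 := vec_smul (-1) (hf (n + 1))
      rw [neg_one_smul, neg_one_smul] at h5
      rw [h5]
      simp
  have := main n 0
  rwa [U.op_zero] at this

end SpectralMeasure

/-! ### Exponential moments of symmetric measures -/

namespace SpectralMeasure

/-- The weight `(1 + |p|)^{-n}`. -/
noncomputable def decay (n : ℕ) (p : ℝ) : ℝ≥0∞ := ENNReal.ofReal (((1 + |p|) ^ n)⁻¹)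

theorem measurable_decay (n : ℕ) : Measurable (decay n) := by
  unfold decay
  fun_prop

/-- The two-sided form of temperedness: `e^{π|p|} dμ(p)` integrates some `(1 + |p|)^{-n}`. -/
def HasTemperedExpMoment (μ : Measure ℝ) : Prop :=
  ∃ n : ℕ, ∫⁻ p, decay n p * ENNReal.ofReal (Real.exp (Real.pi * |p|)) ∂μ < ⊤

/-- For a symmetric measure, one-sided exponential moments control two-sided ones. -/
theorem lintegral_mul_exp_abs_le {μ : Measure ℝ} (hμ : μ.map Neg.neg = μ) {w : ℝ → ℝ≥0∞}
    (hw : Measurable w) (hw' : ∀ p, w (-p) = w p) (c : ℝ) :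
    ∫⁻ p, w p * ENNReal.ofReal (Real.exp (c * |p|)) ∂μ
      ≤ 2 * ∫⁻ p, w p * ENNReal.ofReal (Real.exp (c * p)) ∂μ := by
  have h1 : ∫⁻ p, w p * ENNReal.ofReal (Real.exp (c * -p)) ∂μ
      = ∫⁻ p, w p * ENNReal.ofReal (Real.exp (c * p)) ∂μ := by
    conv_rhs => rw [← hμ]
    rw [lintegral_map (by fun_prop) measurable_neg]
    simp only [hw']
  rw [two_mul]
  conv_rhs => enter [2]; rw [← h1]
  rw [← lintegral_add_left (by fun_prop)]
  refine lintegral_mono fun p => ?_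
  rw [← mul_add]
  gcongr
  rcases abs_choice p with h | h
  · rw [h]; exact le_self_add
  · rw [h]; exact le_add_self

theorem hasTemperateGrowth_withDensity_iff {μ : Measure ℝ} :
    (μ.withDensity fun p => ENNReal.ofReal (Real.exp (Real.pi * p))).HasTemperateGrowth ↔
      ∃ n : ℕ, ∫⁻ p, decay n p * ENNReal.ofReal (Real.exp (Real.pi * p)) ∂μ < ⊤ := by
  have key : ∀ n : ℕ, Integrable (fun x : ℝ => (1 + ‖x‖) ^ (-(n : ℝ)))
      (μ.withDensity fun p => ENNReal.ofReal (Real.exp (Real.pi * p))) ↔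
      ∫⁻ p, decay n p * ENNReal.ofReal (Real.exp (Real.pi * p)) ∂μ < ⊤ := by
    intro n
    have hm : Measurable fun x : ℝ => (1 + ‖x‖) ^ (-(n : ℝ)) := by fun_prop
    have he : ∀ x : ℝ, ‖(1 + ‖x‖) ^ (-(n : ℝ))‖ₑ = decay n x := by
      intro x
      have : 0 ≤ 1 + ‖x‖ := by positivity
      rw [Real.enorm_eq_ofReal (by positivity), decay, Real.rpow_neg this, Real.rpow_natCast,
        Real.norm_eq_abs]
    rw [Integrable, and_iff_right hm.aestronglyMeasurable, HasFiniteIntegral]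
    simp only [he]
    rw [lintegral_withDensity_eq_lintegral_mul _ (by fun_prop) (measurable_decay n)]
    simp only [Pi.mul_apply, mul_comm]
  exact ⟨fun h => h.exists_integrable.imp fun n hn => (key n).1 hn,
    fun ⟨n, hn⟩ => ⟨n, (key n).2 hn⟩⟩

theorem hasTemperateGrowth_iff_hasTemperedExpMoment {μ : Measure ℝ} (hμ : μ.map Neg.neg = μ) :
    (μ.withDensity fun p => ENNReal.ofReal (Real.exp (Real.pi * p))).HasTemperateGrowth ↔
      HasTemperedExpMoment μ := by
  rw [hasTemperateGrowth_withDensity_iff]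
  refine exists_congr fun n => ⟨fun h => ?_, fun h => ?_⟩
  · refine (lintegral_mul_exp_abs_le hμ (measurable_decay n) (fun p => ?_) _).trans_lt
      (ENNReal.mul_lt_top (by simp) h)
    rw [decay, decay, abs_neg]
  · refine (lintegral_mono fun p => ?_).trans_lt h
    gcongr
    exact le_abs_self p

/-- The bound `(1 + x)ⁿ ≤ K δ⁻ⁿ e^{δx}`, with `K` independent of `δ`. -/
theorem exists_pow_mul_one_add_pow_le_exp (n : ℕ) : ∃ K : ℝ, 0 < K ∧
    ∀ δ x : ℝ, 0 < δ → δ ≤ 2 → 0 ≤ x → δ ^ n * (1 + x) ^ n ≤ K * Real.exp (δ * x) := by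
  -- For `n ≥ 1`, this is the `n`-th power of `δ(1 + x) ≤ 2n(1 + δx/n) ≤ 2n e^{δx/n}`.
  rcases Nat.eq_zero_or_pos n with rfl | hn
  · refine ⟨1, one_pos, fun δ x h0 _ hx => ?_⟩
    simpa using mul_nonneg h0.le hx
  have hn' : (1 : ℝ) ≤ n := by exact_mod_cast hn
  refine ⟨(2 * n) ^ n, by positivity, fun δ x h0 h2 hx => ?_⟩
  have hy : 0 ≤ δ * x := by positivity
  have h1 : δ * (1 + x) ≤ 2 * n * Real.exp (δ * x / n) := by
    have h3 := Real.add_one_le_exp (δ * x / n)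
    have h4 : 2 * n * (δ * x / n + 1) = 2 * (δ * x) + 2 * n := by field_simp
    have h5 : 2 * (n : ℝ) * (δ * x / n + 1) ≤ 2 * n * Real.exp (δ * x / n) := by gcongr
    linarith
  calc δ ^ n * (1 + x) ^ n = (δ * (1 + x)) ^ n := (mul_pow _ _ _).symm
    _ ≤ (2 * n * Real.exp (δ * x / n)) ^ n := pow_le_pow_left₀ (by positivity) h1 n
    _ = (2 * n) ^ n * Real.exp (δ * x) := by
      rw [mul_pow, ← Real.exp_nat_mul]
      congr 2
      field_simp

/-- Temperedness bounds the growth of the exponential moments towards the boundary of the strip: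
`(1 + x)ⁿ e^{-δx} = O(δ⁻ⁿ)`. -/
theorem HasTemperedExpMoment.exists_bound {μ : Measure ℝ} (h : HasTemperedExpMoment μ) :
    ∃ C N : ℝ, 0 < C ∧ 0 < N ∧ ∀ t : ℝ, |t| < Real.pi / 2 →
      ∫⁻ p, ENNReal.ofReal (Real.exp (2 * t * p)) ∂μ
        ≤ ENNReal.ofReal (C * (Real.pi / 2 - |t|) ^ (-N)) := by
  obtain ⟨n, hn⟩ := h
  set I := ∫⁻ p, decay n p * ENNReal.ofReal (Real.exp (Real.pi * |p|)) ∂μ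
  obtain ⟨K, hK, hK'⟩ := exists_pow_mul_one_add_pow_le_exp (n + 1)
  -- The exponent `n + 1` and the summand `1` make `N` and `C` positive.
  refine ⟨K * (I.toReal + 1), (n + 1 : ℕ), by positivity, by positivity, fun t ht => ?_⟩
  set δ := Real.pi / 2 - |t| with hδ
  have hδ0 : 0 < δ := sub_pos.2 ht
  have hδ2 : δ ≤ 2 := by
    have := abs_nonneg t
    have := Real.pi_lt_four
    linarith
  have hpt : ∀ p : ℝ, ENNReal.ofReal (Real.exp (2 * t * p)) ≤
      ENNReal.ofReal (K * δ ^ (-((n + 1 : ℕ) : ℝ)))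
        * (decay n p * ENNReal.ofReal (Real.exp (Real.pi * |p|))) := by
    intro p
    rw [decay, ← ENNReal.ofReal_mul (by positivity), ← ENNReal.ofReal_mul (by positivity)]
    refine ENNReal.ofReal_le_ofReal ?_
    rw [Real.rpow_neg hδ0.le, Real.rpow_natCast]
    have h1 := hK' δ |p| hδ0 hδ2 (abs_nonneg p)
    have h2 : t * p ≤ |t| * |p| := (le_abs_self _).trans (abs_mul t p).le
    have h3 : Real.exp (2 * t * p) * Real.exp (δ * |p|) ≤ Real.exp (Real.pi * |p|) := by
      rw [← Real.exp_add]
      refine Real.exp_le_exp.2 ?_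
      rw [hδ]
      have : 0 ≤ δ * |p| := by positivity
      rw [hδ] at this
      nlinarith
    have h4 : (1 + |p|) ^ n ≤ (1 + |p|) ^ (n + 1) :=
      pow_le_pow_right₀ (by linarith [abs_nonneg p]) (by omega)
    have hpos : 0 < (1 + |p|) ^ n := by positivity
    have h5 : K * (δ ^ (n + 1))⁻¹ * (((1 + |p|) ^ n)⁻¹ * Real.exp (Real.pi * |p|))
        = (K * Real.exp (Real.pi * |p|)) / (δ ^ (n + 1) * (1 + |p|) ^ n) := by
      field_simp
    rw [h5, le_div_iff₀ (by positivity)]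
    calc Real.exp (2 * t * p) * (δ ^ (n + 1) * (1 + |p|) ^ n)
        ≤ Real.exp (2 * t * p) * (δ ^ (n + 1) * (1 + |p|) ^ (n + 1)) := by gcongr
      _ ≤ Real.exp (2 * t * p) * (K * Real.exp (δ * |p|)) := by gcongr
      _ = K * (Real.exp (2 * t * p) * Real.exp (δ * |p|)) := by ring
      _ ≤ K * Real.exp (Real.pi * |p|) := by gcongr
  have hrp : 0 ≤ δ ^ (-((n + 1 : ℕ) : ℝ)) := by positivity
  calc ∫⁻ p, ENNReal.ofReal (Real.exp (2 * t * p)) ∂μ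
      ≤ ENNReal.ofReal (K * δ ^ (-((n + 1 : ℕ) : ℝ))) * I := by
        rw [← lintegral_const_mul' _ _ ENNReal.ofReal_ne_top]
        exact lintegral_mono hpt
    _ = ENNReal.ofReal (K * δ ^ (-((n + 1 : ℕ) : ℝ)) * I.toReal) := by
        rw [ENNReal.ofReal_mul (p := K * _) (by positivity), ENNReal.ofReal_toReal hn.ne]
    _ ≤ _ := by
        refine ENNReal.ofReal_le_ofReal ?_
        nlinarith [mul_nonneg hK.le hrp]

/-- Conversely, polynomial growth of the exponential moments gives temperedness: on the shell
`k ≤ |p| < k + 1`, the moment for `t = π/2 - 1/(k+1)` controls `e^{π|p|}` up to the factor `e²`,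
and the contributions of the shells are summable against a sufficiently strong weight. -/
theorem hasTemperedExpMoment_of_bound {μ : Measure ℝ} (hμ : μ.map Neg.neg = μ) {C N : ℝ}
    (hC : 0 < C) (h : ∀ t : ℝ, |t| < Real.pi / 2 →
      ∫⁻ p, ENNReal.ofReal (Real.exp (2 * t * p)) ∂μ
        ≤ ENNReal.ofReal (C * (Real.pi / 2 - |t|) ^ (-N))) :
    HasTemperedExpMoment μ := by
  obtain ⟨M, hM⟩ := exists_nat_ge N
  refine ⟨M + 2, ?_⟩
  set t : ℕ → ℝ := fun k => Real.pi / 2 - 1 / (k + 1) with ht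
  have hk1 : ∀ k : ℕ, 1 / ((k : ℝ) + 1) ≤ 1 := fun k => by
    rw [div_le_one (by positivity)]
    linarith [(Nat.cast_nonneg k : (0 : ℝ) ≤ k)]
  have ht0 : ∀ k, |t k| = t k := fun k => abs_of_nonneg (by
    have := Real.pi_gt_three
    have := hk1 k
    simp only [ht]
    linarith)
  have hmom : ∀ k : ℕ, ∫⁻ p, ENNReal.ofReal (Real.exp (2 * t k * |p|)) ∂μ
      ≤ ENNReal.ofReal (2 * C * ((k : ℝ) + 1) ^ M) := by
    intro k
    have hpos : (0 : ℝ) < 1 / (k + 1) := by positivity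
    have h1 := lintegral_mul_exp_abs_le hμ (w := fun _ => 1) measurable_const (fun _ => rfl)
      (2 * t k)
    simp only [one_mul] at h1
    have h2 := h (t k) (by rw [ht0]; simp only [ht]; linarith)
    rw [ht0] at h2
    have h3 : Real.pi / 2 - t k = ((k : ℝ) + 1)⁻¹ := by simp [ht]
    rw [h3, Real.inv_rpow (by positivity), Real.rpow_neg (by positivity), inv_inv] at h2
    have h4 : ((k : ℝ) + 1) ^ N ≤ ((k : ℝ) + 1) ^ M := by
      rw [← Real.rpow_natCast]
      exact Real.rpow_le_rpow_of_exponent_le (by linarith [(Nat.cast_nonneg k : (0 : ℝ) ≤ k)]) hM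
    calc _ ≤ _ := h1
      _ ≤ 2 * ENNReal.ofReal (C * ((k : ℝ) + 1) ^ N) := by gcongr
      _ = ENNReal.ofReal (2 * (C * ((k : ℝ) + 1) ^ N)) := by
        rw [ENNReal.ofReal_mul (p := 2) (by norm_num), ENNReal.ofReal_ofNat]
      _ ≤ _ := ENNReal.ofReal_le_ofReal (by nlinarith)
  have hpt : ∀ p : ℝ, decay (M + 2) p * ENNReal.ofReal (Real.exp (Real.pi * |p|)) ≤
      ∑' k : ℕ, ENNReal.ofReal (Real.exp 2 * (((k : ℝ) + 1) ^ (M + 2))⁻¹)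
        * ENNReal.ofReal (Real.exp (2 * t k * |p|)) := by
    intro p
    refine le_trans ?_ (ENNReal.le_tsum ⌊|p|⌋₊)
    set k := ⌊|p|⌋₊
    have hk : (k : ℝ) ≤ |p| := Nat.floor_le (abs_nonneg p)
    have hk' : |p| ≤ k + 1 := (Nat.lt_floor_add_one |p|).le
    rw [decay, ← ENNReal.ofReal_mul (by positivity), ← ENNReal.ofReal_mul (by positivity)]
    refine ENNReal.ofReal_le_ofReal ?_
    have h1 : Real.exp (Real.pi * |p|) ≤ Real.exp 2 * Real.exp (2 * t k * |p|) := by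
      rw [← Real.exp_add]
      refine Real.exp_le_exp.2 ?_
      have h2 : |p| / (k + 1) ≤ 1 := (div_le_one (by positivity)).2 hk'
      have h3 : 2 * t k * |p| = Real.pi * |p| - 2 * (|p| / (k + 1)) := by
        simp only [ht]
        ring
      linarith
    have h2 : ((1 + |p|) ^ (M + 2))⁻¹ ≤ (((k : ℝ) + 1) ^ (M + 2))⁻¹ := by
      refine inv_anti₀ (by positivity) (pow_le_pow_left₀ (by positivity) ?_ _)
      linarith
    calc _ ≤ (((k : ℝ) + 1) ^ (M + 2))⁻¹ * (Real.exp 2 * Real.exp (2 * t k * |p|)) := by gcongr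
      _ = _ := by ring
  have hsum : Summable fun k : ℕ => 2 * C * Real.exp 2 * (((k : ℝ) + 1) ^ 2)⁻¹ := by
    refine Summable.mul_left _ ?_
    have := (summable_nat_add_iff 1).2 (Real.summable_nat_pow_inv.2 (by norm_num : 1 < 2))
    simpa using this
  calc _ ≤ ∫⁻ p, ∑' k : ℕ, ENNReal.ofReal (Real.exp 2 * (((k : ℝ) + 1) ^ (M + 2))⁻¹)
        * ENNReal.ofReal (Real.exp (2 * t k * |p|)) ∂μ := lintegral_mono hpt
    _ = ∑' k : ℕ, ENNReal.ofReal (Real.exp 2 * (((k : ℝ) + 1) ^ (M + 2))⁻¹)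
        * ∫⁻ p, ENNReal.ofReal (Real.exp (2 * t k * |p|)) ∂μ := by
      rw [lintegral_tsum fun k => (by fun_prop)]
      simp_rw [lintegral_const_mul' _ _ ENNReal.ofReal_ne_top]
    _ ≤ ∑' k : ℕ, ENNReal.ofReal (2 * C * Real.exp 2 * (((k : ℝ) + 1) ^ 2)⁻¹) := by
      refine ENNReal.tsum_le_tsum fun k => ?_
      refine (mul_le_mul_right (hmom k) _).trans_eq ?_
      rw [← ENNReal.ofReal_mul (by positivity)]
      congr 1
      field_simp
      ring
    _ < ⊤ := by
      rw [← ENNReal.ofReal_tsum_of_nonneg (fun k => by positivity) hsum]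
      exact ENNReal.ofReal_lt_top

/-- If the exponentials `e^{tp}`, `|t| < π/2`, are square integrable, then so are their products
with polynomially bounded functions. -/
theorem memLp_of_norm_le_pow_mul_exp {μ : Measure ℝ}
    (hμ : ∀ t : ℝ, |t| < Real.pi / 2 → MemLp (fun p : ℝ => ((Real.exp (t * p) : ℝ) : ℂ)) 2 μ)
    {t : ℝ} (ht : |t| < Real.pi / 2) {F : ℝ → ℂ} (hF : Measurable F) (n : ℕ)
    (hle : ∀ p, ‖F p‖ ≤ (1 + |p|) ^ n * Real.exp (t * p)) : MemLp F 2 μ := by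
  -- Half of the distance to the boundary pays for the polynomial factor.
  set δ := (Real.pi / 2 - |t|) / 2 with hδ
  have hδ0 : 0 < δ := by
    have := sub_pos.2 ht
    positivity
  have hδ2 : δ ≤ 2 := by
    have := abs_nonneg t
    have := Real.pi_lt_four
    linarith
  obtain ⟨K, hK, hK'⟩ := exists_pow_mul_one_add_pow_le_exp n
  have hs : |(|t| + δ)| < Real.pi / 2 := by
    rw [abs_of_nonneg (by positivity), hδ]
    linarith
  have h1 := (hμ _ hs).add (hμ (-(|t| + δ)) (by rwa [abs_neg]))
  refine (h1.const_mul ((K / δ ^ n : ℝ) : ℂ)).of_le hF.aestronglyMeasurable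
    (ae_of_all _ fun p => (hle p).trans ?_)
  have h2 : ‖((K / δ ^ n : ℝ) : ℂ) * ((Real.exp ((|t| + δ) * p) : ℝ) +
      (Real.exp (-(|t| + δ) * p) : ℝ) : ℂ)‖
      = K / δ ^ n * (Real.exp ((|t| + δ) * p) + Real.exp (-(|t| + δ) * p)) := by
    rw [← Complex.ofReal_add, ← Complex.ofReal_mul, Complex.norm_real, Real.norm_eq_abs,
      abs_of_nonneg (by positivity)]
  refine le_of_le_of_eq ?_ h2.symm
  have h3 : Real.exp ((|t| + δ) * |p|)
      ≤ Real.exp ((|t| + δ) * p) + Real.exp (-(|t| + δ) * p) := by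
    rcases abs_choice p with h | h
    · rw [h]
      linarith [Real.exp_pos (-(|t| + δ) * p)]
    · rw [h, mul_neg, ← neg_mul]
      linarith [Real.exp_pos ((|t| + δ) * p)]
  have h4 : (1 + |p|) ^ n ≤ K / δ ^ n * Real.exp (δ * |p|) := by
    rw [div_mul_eq_mul_div, le_div_iff₀ (by positivity), mul_comm]
    exact hK' δ |p| hδ0 hδ2 (abs_nonneg p)
  have h5 : Real.exp (t * p) ≤ Real.exp (|t| * |p|) :=
    Real.exp_le_exp.2 ((le_abs_self _).trans (abs_mul t p).le)
  calc (1 + |p|) ^ n * Real.exp (t * p)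
      ≤ K / δ ^ n * Real.exp (δ * |p|) * Real.exp (|t| * |p|) := by gcongr
    _ = K / δ ^ n * Real.exp ((|t| + δ) * |p|) := by
      rw [mul_assoc, ← Real.exp_add]
      congr 2
      ring
    _ ≤ _ := by gcongr

end SpectralMeasure

/-! ### The antilinear functionals `φ ↦ ⟨(1 + iA)^m φ, w⟩` on smooth vectors -/

namespace SpectralMeasure

section

variable {H : Type*} [NormedAddCommGroup H] [InnerProductSpace ℂ H]
  {U : UnitaryOneParameterGroup H}

theorem continuous_derivAtZero (n : ℕ) : Continuous (U.derivAtZero n) := by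
  refine U.withSeminorms.continuous_of_isBounded (norm_withSeminorms ℂ H) (U.derivAtZero n) ?_
  intro _
  refine ⟨{n}, 1, fun v => ?_⟩
  simp [UnitaryOneParameterGroup.smoothSeminorms]

theorem toDistribution_apply (w : H) (φ : U.SmoothVectors) :
    U.toDistribution w φ = ⟪U.incl φ, w⟫_ℂ :=
  rfl

/-- The distribution vector `(1 - iA)^m w`, defined by duality as
`φ ↦ ⟨(1 + iA)^m φ, w⟩`; on smooth vectors, `(iA)ᵏ` is `U.derivAtZero k`. -/
noncomputable def dualPow (U : UnitaryOneParameterGroup H) (m : ℕ) (w : H) :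
    U.DistributionVectors :=
  ({ toFun := fun φ => ∑ k ∈ Finset.range (m + 1), (m.choose k : ℂ) * ⟪U.derivAtZero k φ, w⟫_ℂ
     map_add' := fun φ ψ => by
      simp only [map_add, inner_add_left, mul_add, Finset.sum_add_distrib]
     map_smul' := fun c φ => by
      simp only [map_smul, inner_smul_left, smul_eq_mul, Finset.mul_sum]
      exact Finset.sum_congr rfl fun k _ => by ring
     cont := continuous_finsetSum _ fun k _ => continuous_const.mul
      ((continuous_derivAtZero k).inner continuous_const) } :
    U.SmoothVectors →SL[starRingEnd ℂ] ℂ)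

theorem dualPow_apply (m : ℕ) (w : H) (φ : U.SmoothVectors) :
    dualPow U m w φ = ∑ k ∈ Finset.range (m + 1), (m.choose k : ℂ) * ⟪U.derivAtZero k φ, w⟫_ℂ :=
  rfl

/-! ### Vectors fixed by the conjugation -/

/-- Inner products of vectors fixed by a conjugation are real. -/
theorem im_inner_eq_zero (J : H ≃ₗᵢ⋆[ℂ] H) {x y : H} (hx : J x = x) (hy : J y = y) :
    (⟪x, y⟫_ℂ).im = 0 := by
  have h1 : ‖x + Complex.I • y‖ = ‖x - Complex.I • y‖ := by
    rw [← J.norm_map (x + Complex.I • y), map_add, map_smulₛₗ, hx, hy, Complex.conj_I, neg_smul,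
      sub_eq_add_neg]
  have h2 := @norm_add_sq ℂ _ _ _ _ x (Complex.I • y)
  have h3 := @norm_sub_sq ℂ _ _ _ _ x (Complex.I • y)
  rw [h1, h3, inner_smul_right] at h2
  simp only [RCLike.re_to_complex, Complex.mul_re, Complex.I_re, Complex.I_im] at h2
  linarith

end

variable {H : Type*} [NormedAddCommGroup H] [InnerProductSpace ℂ H] [CompleteSpace H]
  {P : SpectralMeasure H} {U : UnitaryOneParameterGroup H} {v : H}

/-- If `J` commutes with `U`, then the spectral measures of the vectors fixed by `J` are
symmetric: the Fourier transform `⟨v, U_t v⟩` of `P^v` is real. -/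
theorem map_neg_scalar (hP : P.IsSpectralMeasureOf U) (J : H ≃ₗᵢ⋆[ℂ] H)
    (hJU : ∀ t w, J (U.op t w) = U.op t (J w)) (hJv : J v = v) :
    (P.scalar v).map Neg.neg = P.scalar v := by
  have hreal : ∀ t, ⟪v, U.op (-t) v⟫_ℂ = ⟪v, U.op t v⟫_ℂ := by
    intro t
    have h1 : ⟪v, U.op (-t) v⟫_ℂ = ⟪U.op t v, v⟫_ℂ := by
      rw [← (U.op t).inner_map_map, ← U.op_add, add_neg_cancel, U.op_zero]
    rw [h1, ← inner_conj_symm, Complex.conj_eq_iff_im]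
    exact im_inner_eq_zero J hJv (by rw [hJU, hJv])
  have hchar : ∀ t, charFun (P.scalar v) t = ⟪v, U.op t v⟫_ℂ := by
    intro t
    rw [hP, charFun_apply_real]
    refine integral_congr_ae (ae_of_all _ fun p => ?_)
    ring_nf
  refine Measure.ext_of_charFun (funext fun t => ?_)
  rw [hchar, ← hreal, ← hchar, charFun_apply_real, charFun_apply_real,
    integral_map (by fun_prop) (by fun_prop)]
  refine integral_congr_ae (ae_of_all _ fun p => ?_)
  push_cast
  ring_nf

theorem expOp_eq_vec {t : ℝ} (h : v ∈ (P.expOp t).domain) :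
    P.expOp t ⟨v, h⟩ = P.vec v fun p => ((Real.exp (t * p) : ℝ) : ℂ) :=
  integral_eq_vec _ h

theorem ofReal_norm_expOp_sq {t : ℝ} (h : v ∈ (P.expOp t).domain) :
    ENNReal.ofReal (‖P.expOp t ⟨v, h⟩‖ ^ 2)
      = ∫⁻ p, ENNReal.ofReal (Real.exp (2 * t * p)) ∂(P.scalar v) := by
  rw [expOp_eq_vec, enorm_vec_sq h]
  refine lintegral_congr fun p => ?_
  rw [← ofReal_norm, Complex.norm_real, Real.norm_eq_abs, Real.abs_exp,
    ← ENNReal.ofReal_pow (by positivity), ← Real.exp_nat_mul]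
  congr 2
  push_cast
  ring

/-! ### Temperedness and boundary values -/

/-- The function `(1 - ip)^{-m} e^{-tp}`. -/
noncomputable def dampedExp (m : ℕ) (t p : ℝ) : ℂ :=
  ((Real.exp (-t * p) : ℝ) : ℂ) / (1 + -(Complex.I * p)) ^ m

theorem norm_one_sub_I_mul_sq (p : ℝ) : ‖1 + -(Complex.I * (p : ℂ))‖ ^ 2 = 1 + p ^ 2 := by
  rw [← Complex.normSq_eq_norm_sq, Complex.normSq_apply]
  simp
  ring

theorem one_le_norm_one_sub_I_mul (p : ℝ) : 1 ≤ ‖1 + -(Complex.I * (p : ℂ))‖ := by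
  have := norm_one_sub_I_mul_sq p
  nlinarith [norm_nonneg (1 + -(Complex.I * (p : ℂ))), sq_nonneg p]

theorem one_sub_I_mul_ne_zero (p : ℝ) : 1 + -(Complex.I * (p : ℂ)) ≠ 0 :=
  norm_pos_iff.1 (one_pos.trans_le (one_le_norm_one_sub_I_mul p))

theorem measurable_dampedExp (m : ℕ) (t : ℝ) : Measurable (dampedExp m t) := by
  unfold dampedExp
  fun_prop

theorem norm_dampedExp (m : ℕ) (t p : ℝ) :
    ‖dampedExp m t p‖ = Real.exp (-t * p) / ‖1 + -(Complex.I * (p : ℂ))‖ ^ m := by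
  rw [dampedExp, norm_div, norm_pow, Complex.norm_real, Real.norm_eq_abs, Real.abs_exp]

theorem norm_dampedExp_sq_le (m : ℕ) {t : ℝ} (ht : |t| ≤ Real.pi / 2) (p : ℝ) :
    ‖dampedExp m t p‖ₑ ^ 2
      ≤ ENNReal.ofReal (2 ^ m) * (decay m p * ENNReal.ofReal (Real.exp (Real.pi * |p|))) := by
  rw [← ofReal_norm, decay, ← ENNReal.ofReal_mul (by positivity),
    ← ENNReal.ofReal_mul (by positivity), ← ENNReal.ofReal_pow (norm_nonneg _)]
  refine ENNReal.ofReal_le_ofReal ?_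
  have h1 : 1 + |p| ≤ 2 * (1 + p ^ 2) := by nlinarith [sq_abs p, abs_nonneg p, sq_nonneg (|p| - 1)]
  have h2 : Real.exp (-t * p) ^ 2 ≤ Real.exp (Real.pi * |p|) := by
    rw [← Real.exp_nat_mul]
    refine Real.exp_le_exp.2 ?_
    have h3 : -t * p ≤ |t| * |p| := by
      rw [← abs_neg t, ← abs_mul]
      exact le_abs_self _
    push_cast
    nlinarith [abs_nonneg p]
  rw [norm_dampedExp, div_pow, ← pow_mul, mul_comm m 2, pow_mul, norm_one_sub_I_mul_sq]
  have h4 : (2 : ℝ) ^ m * (((1 + |p|) ^ m)⁻¹ * Real.exp (Real.pi * |p|))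
      = Real.exp (Real.pi * |p|) / ((1 + |p|) / 2) ^ m := by
    rw [div_pow]
    field_simp
  rw [h4]
  gcongr
  linarith

/-- `e^{-tA} v = (1 - iA)^m w` for `w = (1 - iA)^{-m} e^{-tA} v`. -/
theorem toDistribution_vec_exp (hP : P.IsSpectralMeasureOf U)
    (hv : ∀ t : ℝ, |t| < Real.pi / 2 →
      MemLp (fun p : ℝ => ((Real.exp (t * p) : ℝ) : ℂ)) 2 (P.scalar v))
    (m : ℕ) {t : ℝ} (ht : |t| < Real.pi / 2) :
    U.toDistribution (P.vec v fun p => ((Real.exp (-t * p) : ℝ) : ℂ))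
      = dualPow U m (P.vec v (dampedExp m t)) := by
  have hmem : ∀ n : ℕ,
      MemLp (fun p : ℝ => (-(Complex.I * p)) ^ n * dampedExp m t p) 2 (P.scalar v) := by
    intro n
    refine memLp_of_norm_le_pow_mul_exp hv (t := -t) (by rwa [abs_neg])
      (Measurable.mul (by fun_prop) (measurable_dampedExp m t)) n fun p => ?_
    rw [norm_mul, norm_pow, norm_neg, norm_mul, Complex.norm_I, one_mul, Complex.norm_real,
      Real.norm_eq_abs, norm_dampedExp]
    gcongr
    · linarith
    · exact div_le_self (Real.exp_pos _).le (one_le_pow₀ (one_le_norm_one_sub_I_mul p))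
  ext φ
  rw [dualPow_apply, toDistribution_apply]
  have h1 : (fun p : ℝ => ((Real.exp (-t * p) : ℝ) : ℂ)) = fun p : ℝ =>
      ∑ k ∈ Finset.range (m + 1),
        (m.choose k : ℂ) * ((-(Complex.I * p)) ^ k * dampedExp m t p) := by
    funext p
    have h2 := add_pow (-(Complex.I * (p : ℂ))) 1 m
    simp only [one_pow, mul_one] at h2
    have h3 : ((Real.exp (-t * p) : ℝ) : ℂ)
        = (-(Complex.I * (p : ℂ)) + 1) ^ m * dampedExp m t p := by
      rw [dampedExp, add_comm (-(Complex.I * (p : ℂ))) 1,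
        mul_div_cancel₀ _ (pow_ne_zero _ (one_sub_I_mul_ne_zero p))]
    rw [h3, h2, Finset.sum_mul]
    exact Finset.sum_congr rfl fun k _ => by ring
  rw [h1, vec_sum _ _ fun k _ => (hmem k).const_mul _, inner_sum]
  refine Finset.sum_congr rfl fun k _ => ?_
  rw [vec_const_mul _ (hmem k), inner_smul_right, inner_derivAtZero_vec hP φ hmem]

theorem tendsto_vec_dampedExp {m : ℕ}
    (hm : ∫⁻ p, decay m p * ENNReal.ofReal (Real.exp (Real.pi * |p|)) ∂(P.scalar v) < ⊤)
    {c : ℝ} (hc : |c| ≤ Real.pi / 2) :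
    Tendsto (fun t : {t : ℝ // |t| < Real.pi / 2} => P.vec v (dampedExp m t.1))
      (comap Subtype.val (𝓝 c)) (𝓝 (P.vec v (dampedExp m c))) := by
  set G : ℝ → ℝ≥0∞ := fun p =>
    ENNReal.ofReal (2 ^ m) * (decay m p * ENNReal.ofReal (Real.exp (Real.pi * |p|))) with hG
  have hGfin : ∫⁻ p, G p ∂(P.scalar v) < ⊤ := by
    rw [lintegral_const_mul' _ _ ENNReal.ofReal_ne_top]
    exact ENNReal.mul_lt_top ENNReal.ofReal_lt_top hm
  have hmem : ∀ t : ℝ, |t| ≤ Real.pi / 2 → MemLp (dampedExp m t) 2 (P.scalar v) := by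
    intro t ht
    refine ⟨(measurable_dampedExp m t).aestronglyMeasurable, ?_⟩
    rw [eLpNorm_lt_top_iff_lintegral_rpow_enorm_lt_top (by simp) (by simp)]
    refine lt_of_le_of_lt (lintegral_mono fun p => ?_) hGfin
    simpa only [ENNReal.toReal_ofNat, ENNReal.rpow_ofNat] using norm_dampedExp_sq_le m ht p
  have h0 : Tendsto (fun t : {t : ℝ // |t| < Real.pi / 2} =>
      ∫⁻ p, ‖dampedExp m t.1 p - dampedExp m c p‖ₑ ^ 2 ∂(P.scalar v))
      (comap Subtype.val (𝓝 c)) (𝓝 (∫⁻ _, 0 ∂(P.scalar v))) := by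
    refine tendsto_lintegral_filter_of_dominated_convergence (fun p => 4 * G p)
      (Eventually.of_forall fun t => ?_) (Eventually.of_forall fun t => ae_of_all _ fun p => ?_)
      ?_ (ae_of_all _ fun p => ?_)
    · exact ((measurable_dampedExp m t.1).sub (measurable_dampedExp m c)).enorm.pow_const 2
    · have h1 := norm_dampedExp_sq_le m t.2.le p
      have h2 := norm_dampedExp_sq_le m hc p
      calc ‖dampedExp m t.1 p - dampedExp m c p‖ₑ ^ 2
          ≤ (‖dampedExp m t.1 p‖ₑ + ‖dampedExp m c p‖ₑ) ^ 2 := by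
            gcongr
            exact enorm_sub_le
        _ ≤ 2 * (‖dampedExp m t.1 p‖ₑ ^ 2 + ‖dampedExp m c p‖ₑ ^ 2) := by
            have := ENNReal.rpow_add_le_mul_rpow_add_rpow ‖dampedExp m t.1 p‖ₑ
              ‖dampedExp m c p‖ₑ (p := 2) (by norm_num)
            norm_num at this
            exact this
        _ ≤ 2 * (G p + G p) := by gcongr
        _ = 4 * G p := by ring
    · rw [lintegral_const_mul' _ _ (by simp)]
      exact ENNReal.mul_ne_top (by simp) hGfin.ne
    · have h1 : Tendsto (fun t : {t : ℝ // |t| < Real.pi / 2} => dampedExp m t.1 p)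
          (comap Subtype.val (𝓝 c)) (𝓝 (dampedExp m c p)) := by
        have h2 : Continuous fun t : ℝ => dampedExp m t p := by
          unfold dampedExp
          fun_prop
        exact (h2.tendsto c).comp tendsto_comap
      have h3 := ((ENNReal.continuous_pow 2).tendsto _).comp (h1.sub_const (dampedExp m c p)).enorm
      simpa [Function.comp_def] using h3
  rw [lintegral_zero] at h0
  rw [tendsto_iff_norm_sub_tendsto_zero]
  have h4 : ∀ t : {t : ℝ // |t| < Real.pi / 2},
      ‖P.vec v (dampedExp m t.1) - P.vec v (dampedExp m c)‖ ^ 2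
      = (∫⁻ p, ‖dampedExp m t.1 p - dampedExp m c p‖ₑ ^ 2 ∂(P.scalar v)).toReal := by
    intro t
    have h5 := enorm_vec_sq ((hmem _ t.2.le).sub (hmem c hc))
    simp only [Pi.sub_apply] at h5
    rw [← h5, vec_sub (hmem _ t.2.le) (hmem c hc), ENNReal.toReal_ofReal (by positivity)]
  have h6 := (ENNReal.tendsto_toReal (by simp)).comp h0
  have h7 := (h6.congr fun t => (h4 t).symm).sqrt
  simpa using h7

/-- Temperedness implies the existence of the boundary values: near the boundary of the strip,
`e^{-tA} v = (1 - iA)^m w_t` with vectors `w_t` that converge in norm. -/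
theorem HasTemperedExpMoment.exists_boundaryValue (hP : P.IsSpectralMeasureOf U)
    (h : HasTemperedExpMoment (P.scalar v))
    (hv : ∀ t : ℝ, |t| < Real.pi / 2 → v ∈ (P.expOp t).domain)
    {c : ℝ} (hc : |c| ≤ Real.pi / 2) :
    ∃ β : U.DistributionVectors,
      Tendsto (fun t : {t : ℝ // |t| < Real.pi / 2} =>
        U.toDistribution (P.expOp (-t.1) ⟨v, hv (-t.1) (by rw [abs_neg]; exact t.2)⟩))
        (comap Subtype.val (𝓝 c)) (𝓝 β) := by
  obtain ⟨m, hm⟩ := h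
  refine ⟨dualPow U m (P.vec v (dampedExp m c)), ?_⟩
  rw [PointwiseConvergenceCLM.tendsto_iff_forall_tendsto]
  intro φ
  have h1 : ∀ t : {t : ℝ // |t| < Real.pi / 2},
      U.toDistribution (P.expOp (-t.1) ⟨v, hv (-t.1) (by rw [abs_neg]; exact t.2)⟩)
        = dualPow U m (P.vec v (dampedExp m t.1)) := by
    intro t
    rw [expOp_eq_vec]
    exact toDistribution_vec_exp hP hv m t.2
  simp only [h1, dualPow_apply]
  exact tendsto_finsetSum _ fun k _ =>
    (tendsto_const_nhds.inner (tendsto_vec_dampedExp hm hc)).const_mul _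

end SpectralMeasure

/-! ### Test vectors for the boundary value -/

namespace SpectralMeasure

variable {H : Type*} [NormedAddCommGroup H] [InnerProductSpace ℂ H] [CompleteSpace H]
  {P : SpectralMeasure H} {U : UnitaryOneParameterGroup H} {v : H}

/-- The pairing of `β^+(v)` with its test vectors: `(1 + p²)^{-m} e^{-πp}`, cut off at
`|p| = R`. -/
noncomputable def cutoffWeight (m : ℕ) (R p : ℝ) : ℝ :=
  (Icc (-R) R).indicator (fun p => Real.exp (-(Real.pi * p)) / (1 + p ^ 2) ^ m) p

/-- The spectral function `(1 + p²)^{-m} e^{-πp/2}`, cut off at `|p| = R`, of the test vectors. -/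
noncomputable def cutoffTest (m : ℕ) (R p : ℝ) : ℂ :=
  (Icc (-R) R).indicator
    (fun p : ℝ => ((Real.exp (-(Real.pi / 2 * p)) / (1 + p ^ 2) ^ m : ℝ) : ℂ)) p

theorem measurable_cutoffTest (m : ℕ) (R : ℝ) : Measurable (cutoffTest m R) := by
  refine Measurable.indicator ?_ measurableSet_Icc
  fun_prop

theorem measurable_cutoffWeight (m : ℕ) (R : ℝ) : Measurable (cutoffWeight m R) := by
  refine Measurable.indicator ?_ measurableSet_Icc
  fun_prop

theorem cutoffWeight_nonneg (m : ℕ) (R p : ℝ) : 0 ≤ cutoffWeight m R p :=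
  indicator_nonneg (fun _ _ => by positivity) _

theorem norm_pow_mul_cutoffTest_le (m n : ℕ) (R p : ℝ) :
    ‖(Complex.I * p) ^ n * cutoffTest m R p‖ ≤ |R| ^ n * Real.exp (Real.pi / 2 * |R|) := by
  by_cases hp : p ∈ Icc (-R) R
  · have hpR : |p| ≤ |R| := (abs_le.2 hp).trans (le_abs_self R)
    have h1 : (1 : ℝ) ≤ (1 + p ^ 2) ^ m := one_le_pow₀ (by nlinarith [sq_nonneg p])
    rw [cutoffTest, indicator_of_mem hp, norm_mul, norm_pow, norm_mul, Complex.norm_I, one_mul,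
      Complex.norm_real, Complex.norm_real, Real.norm_eq_abs, Real.norm_eq_abs,
      abs_of_nonneg (a := _ / _) (by positivity)]
    gcongr
    refine (div_le_self (Real.exp_pos _).le h1).trans (Real.exp_le_exp.2 ?_)
    have := neg_abs_le p
    nlinarith [Real.pi_pos]
  · rw [cutoffTest, indicator_of_notMem hp, mul_zero, norm_zero]
    positivity

theorem memLp_pow_mul_cutoffTest (μ : Measure ℝ) [IsFiniteMeasure μ] (m n : ℕ) (R : ℝ) :
    MemLp (fun p : ℝ => (Complex.I * p) ^ n * cutoffTest m R p) 2 μ :=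
  MemLp.of_bound (Measurable.mul (by fun_prop) (measurable_cutoffTest m R)).aestronglyMeasurable
    _ (ae_of_all _ (norm_pow_mul_cutoffTest_le m n R))

theorem memLp_cutoffTest (μ : Measure ℝ) [IsFiniteMeasure μ] (m : ℕ) (R : ℝ) :
    MemLp (cutoffTest m R) 2 μ := by
  simpa using memLp_pow_mul_cutoffTest μ m 0 R

theorem enorm_pow_mul_cutoffTest_sq_le {m n : ℕ} (hn : n ≤ m) (R p : ℝ) :
    ‖(Complex.I * p) ^ n * cutoffTest m R p‖ₑ ^ 2 ≤ ENNReal.ofReal (cutoffWeight m R p) := by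
  by_cases hp : p ∈ Icc (-R) R
  · rw [← ofReal_norm, ← ENNReal.ofReal_pow (norm_nonneg _)]
    refine ENNReal.ofReal_le_ofReal ?_
    rw [cutoffTest, cutoffWeight, indicator_of_mem hp, indicator_of_mem hp, norm_mul, norm_pow,
      norm_mul, Complex.norm_I, one_mul, Complex.norm_real, Complex.norm_real, Real.norm_eq_abs,
      Real.norm_eq_abs, abs_of_nonneg (a := _ / _) (by positivity), mul_pow, div_pow,
      ← Real.exp_nat_mul, ← pow_mul, mul_comm n 2, pow_mul, sq_abs]
    have h1 : (p ^ 2) ^ n ≤ (1 + p ^ 2) ^ m :=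
      (pow_le_pow_left₀ (sq_nonneg p) (by linarith) n).trans
        (pow_le_pow_right₀ (by nlinarith [sq_nonneg p]) hn)
    have h2 : ((2 : ℕ) : ℝ) * -(Real.pi / 2 * p) = -(Real.pi * p) := by
      push_cast
      ring
    have h3 : 0 < (1 + p ^ 2) ^ m := by positivity
    rw [h2, mul_div_assoc', div_le_div_iff₀ (by positivity) h3]
    calc (p ^ 2) ^ n * Real.exp (-(Real.pi * p)) * (1 + p ^ 2) ^ m
        ≤ (1 + p ^ 2) ^ m * Real.exp (-(Real.pi * p)) * (1 + p ^ 2) ^ m := by gcongr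
      _ = _ := by ring
  · rw [cutoffTest, indicator_of_notMem hp, mul_zero]
    simp

theorem integrable_cutoffWeight (μ : Measure ℝ) [IsFiniteMeasure μ] (m : ℕ) (R : ℝ) :
    Integrable (cutoffWeight m R) μ := by
  refine Integrable.of_bound (measurable_cutoffWeight m R).aestronglyMeasurable
    (Real.exp (Real.pi * |R|)) (ae_of_all _ fun p => ?_)
  by_cases hp : p ∈ Icc (-R) R
  · have hpR : |p| ≤ |R| := (abs_le.2 hp).trans (le_abs_self R)
    have h1 : (1 : ℝ) ≤ (1 + p ^ 2) ^ m := one_le_pow₀ (by nlinarith [sq_nonneg p])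
    rw [cutoffWeight, indicator_of_mem hp, Real.norm_eq_abs, abs_of_nonneg (by positivity)]
    refine (div_le_self (Real.exp_pos _).le h1).trans (Real.exp_le_exp.2 ?_)
    have := neg_abs_le p
    nlinarith [Real.pi_pos]
  · rw [cutoffWeight, indicator_of_notMem hp, norm_zero]
    positivity

theorem cutoffWeight_eq (m : ℕ) (R p : ℝ) :
    ((cutoffWeight m R p : ℝ) : ℂ) = ((Real.exp (-(Real.pi / 2) * p) : ℝ) : ℂ)
      * (starRingEnd ℂ) (cutoffTest m R p) := by
  by_cases hp : p ∈ Icc (-R) R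
  · rw [cutoffTest, cutoffWeight, indicator_of_mem hp, indicator_of_mem hp, Complex.conj_ofReal,
      ← Complex.ofReal_mul, mul_div_assoc', ← Real.exp_add]
    congr 3
    ring
  · rw [cutoffTest, cutoffWeight, indicator_of_notMem hp, indicator_of_notMem hp]
    simp

/-- The smooth test vector `∫ (1 + p²)^{-m} e^{-πp/2} dP v`, cut off at `|p| = R`. -/
noncomputable def testVector (hP : P.IsSpectralMeasureOf U) (v : H) (m : ℕ) (R : ℝ) :
    U.SmoothVectors :=
  ⟨P.vec v (cutoffTest m R),
    vec_mem_smoothSubmodule hP fun n => memLp_pow_mul_cutoffTest (P.scalar v) m n R⟩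

theorem norm_derivAtZero_testVector_le (hP : P.IsSpectralMeasureOf U) (v : H) {m n : ℕ}
    (hn : n ≤ m) (R : ℝ) :
    ‖U.derivAtZero n (testVector hP v m R)‖ ≤ √(∫ p, cutoffWeight m R p ∂(P.scalar v)) := by
  have hmem := fun n => memLp_pow_mul_cutoffTest (P.scalar v) m n R
  have h1 : U.derivAtZero n (testVector hP v m R)
      = P.vec v fun p : ℝ => (Complex.I * p) ^ n * cutoffTest m R p := by
    have := congrFun (iteratedDeriv_op_vec hP hmem n) 0
    rw [U.op_zero] at this
    exact this
  rw [h1]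
  refine Real.le_sqrt_of_sq_le ?_
  have h0 : 0 ≤ ∫ p, cutoffWeight m R p ∂(P.scalar v) :=
    integral_nonneg (cutoffWeight_nonneg m R)
  rw [← ENNReal.ofReal_le_ofReal_iff h0, enorm_vec_sq (hmem n),
    ofReal_integral_eq_lintegral_ofReal (integrable_cutoffWeight _ m R)
      (ae_of_all _ (cutoffWeight_nonneg m R))]
  exact lintegral_mono (enorm_pow_mul_cutoffTest_sq_le hn R)

theorem neBot_comap_nhds_pi_div_two :
    (comap (Subtype.val : {t : ℝ // |t| < Real.pi / 2} → ℝ) (𝓝 (Real.pi / 2))).NeBot := by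
  have h1 : {t : ℝ | |t| < Real.pi / 2} = Ioo (-(Real.pi / 2)) (Real.pi / 2) := by
    ext t
    exact abs_lt (a := t)
  have hpi := Real.pi_pos
  have h2 : Real.pi / 2 ∈ closure {t : ℝ | |t| < Real.pi / 2} := by
    rw [h1, closure_Ioo (by linarith)]
    exact ⟨by linarith, le_rfl⟩
  exact mem_closure_iff_comap_neBot.1 h2

theorem boundaryValue_testVector (hP : P.IsSpectralMeasureOf U)
    (hv : ∀ t : ℝ, |t| < Real.pi / 2 → v ∈ (P.expOp t).domain) {β : U.DistributionVectors}
    (hβ : Tendsto (fun t : {t : ℝ // |t| < Real.pi / 2} =>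
        U.toDistribution (P.expOp (-t.1) ⟨v, hv (-t.1) (by rw [abs_neg]; exact t.2)⟩))
        (comap Subtype.val (𝓝 (Real.pi / 2))) (𝓝 β)) (m : ℕ) (R : ℝ) :
    β (testVector hP v m R) = ((∫ p, cutoffWeight m R p ∂(P.scalar v) : ℝ) : ℂ) := by
  rw [PointwiseConvergenceCLM.tendsto_iff_forall_tendsto] at hβ
  have := neBot_comap_nhds_pi_div_two
  refine tendsto_nhds_unique (hβ (testVector hP v m R)) ?_
  have hmem := memLp_cutoffTest (P.scalar v) m R
  have h1 : ∀ t : {t : ℝ // |t| < Real.pi / 2},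
      U.toDistribution (P.expOp (-t.1) ⟨v, hv (-t.1) (by rw [abs_neg]; exact t.2)⟩)
        (testVector hP v m R)
      = ∫ p, ((Real.exp (-t.1 * p) : ℝ) : ℂ) * (starRingEnd ℂ) (cutoffTest m R p)
          ∂(P.scalar v) := by
    intro t
    rw [expOp_eq_vec, toDistribution_apply]
    exact inner_vec hmem (hv (-t.1) (by rw [abs_neg]; exact t.2))
  simp only [h1]
  rw [← integral_complex_ofReal]
  simp only [cutoffWeight_eq]
  refine tendsto_integral_filter_of_dominated_convergence
    (fun _ => Real.exp (Real.pi / 2 * |R|) * Real.exp (Real.pi / 2 * |R|))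
    (Eventually.of_forall fun t => ?_) (Eventually.of_forall fun t => ae_of_all _ fun p => ?_)
    (integrable_const _) (ae_of_all _ fun p => ?_)
  · have := measurable_cutoffTest m R
    exact (by fun_prop : Measurable fun p : ℝ => ((Real.exp (-t.1 * p) : ℝ) : ℂ)
      * (starRingEnd ℂ) (cutoffTest m R p)).aestronglyMeasurable
  · by_cases hp : p ∈ Icc (-R) R
    · have hpR : |p| ≤ |R| := (abs_le.2 hp).trans (le_abs_self R)
      have h2 := norm_pow_mul_cutoffTest_le m 0 R p
      rw [pow_zero, one_mul, pow_zero, one_mul] at h2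
      rw [norm_mul, RCLike.norm_conj, Complex.norm_real, Real.norm_eq_abs, Real.abs_exp]
      refine mul_le_mul (Real.exp_le_exp.2 ?_) h2 (norm_nonneg _) (Real.exp_pos _).le
      calc -t.1 * p ≤ |t.1| * |p| := by
            rw [← abs_neg t.1, ← abs_mul]
            exact le_abs_self _
        _ ≤ Real.pi / 2 * |R| := mul_le_mul t.2.le hpR (abs_nonneg p) (by positivity)
    · rw [cutoffTest, indicator_of_notMem hp]
      simp only [map_zero, mul_zero, norm_zero]
      positivity
  · refine Tendsto.mul_const _ ?_
    have h2 : Continuous fun t : ℝ => ((Real.exp (-t * p) : ℝ) : ℂ) := by fun_prop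
    exact (h2.tendsto (Real.pi / 2)).comp tendsto_comap

/-- The existence of `β^+(v)` as a continuous functional implies temperedness. With
`I_R = ∫ (1 + p²)^{-m} e^{-πp} dP^v`, cut off at `|p| = R`, the pairing of `β^+(v)` with the test
vectors is `I_R`, and the relevant seminorms of the test vectors are at most `√I_R`. Hence
`I_R ≤ K √I_R` with `K` independent of `R`, so that `I_R` is bounded. -/
theorem hasTemperedExpMoment_of_tendsto (hP : P.IsSpectralMeasureOf U)
    (hsymm : (P.scalar v).map Neg.neg = P.scalar v)
    (hv : ∀ t : ℝ, |t| < Real.pi / 2 → v ∈ (P.expOp t).domain) {β : U.DistributionVectors}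
    (hβ : Tendsto (fun t : {t : ℝ // |t| < Real.pi / 2} =>
        U.toDistribution (P.expOp (-t.1) ⟨v, hv (-t.1) (by rw [abs_neg]; exact t.2)⟩))
        (comap Subtype.val (𝓝 (Real.pi / 2))) (𝓝 β)) :
    HasTemperedExpMoment (P.scalar v) := by
  let q : Seminorm ℂ U.SmoothVectors := (normSeminorm ℂ ℂ).comp
    (β : U.SmoothVectors →SL[starRingEnd ℂ] ℂ).toLinearMap
  have hq : Continuous q := continuous_norm.comp
    (β : U.SmoothVectors →SL[starRingEnd ℂ] ℂ).continuous
  obtain ⟨s, C, -, hsC⟩ := Seminorm.bound_of_continuous U.withSeminorms q hq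
  set m := s.sup id
  set K : ℝ := (C : ℝ)
  have hbound : ∀ R : ℝ, ∫ p, cutoffWeight m R p ∂(P.scalar v) ≤ K ^ 2 := by
    intro R
    set I := ∫ p, cutoffWeight m R p ∂(P.scalar v) with hI
    have hI0 : 0 ≤ I := integral_nonneg (cutoffWeight_nonneg m R)
    have h1 : I ≤ K * √I := by
      have h2 : q (testVector hP v m R) = I := by
        change ‖β (testVector hP v m R)‖ = I
        rw [boundaryValue_testVector hP hv hβ, Complex.norm_real, Real.norm_eq_abs,
          abs_of_nonneg hI0]
      have h3 : s.sup U.smoothSeminorms (testVector hP v m R) ≤ √I :=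
        Seminorm.finset_sup_apply_le (Real.sqrt_nonneg I) fun k hk =>
          norm_derivAtZero_testVector_le hP v (Finset.le_sup (f := id) hk) R
      calc I = q (testVector hP v m R) := h2.symm
        _ ≤ (C • s.sup U.smoothSeminorms) (testVector hP v m R) := hsC _
        _ = C * s.sup U.smoothSeminorms (testVector hP v m R) := rfl
        _ ≤ K * √I := by gcongr
    have h4 := Real.sq_sqrt hI0
    have hK : 0 ≤ K := C.coe_nonneg
    by_contra! hlt
    have h5 : K < √I := Real.lt_sqrt_of_sq_lt hlt
    nlinarith [Real.sqrt_nonneg I]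
  have hlint : ∫⁻ p, ENNReal.ofReal (Real.exp (-(Real.pi * p)) / (1 + p ^ 2) ^ m)
      ∂(P.scalar v) ≤ ENNReal.ofReal (K ^ 2) := by
    have hcov : ∀ p : ℝ, ENNReal.ofReal (Real.exp (-(Real.pi * p)) / (1 + p ^ 2) ^ m)
        = ⨆ n : ℕ, ENNReal.ofReal (cutoffWeight m n p) := by
      intro p
      refine le_antisymm ?_ (iSup_le fun n => ENNReal.ofReal_le_ofReal ?_)
      · obtain ⟨n, hn⟩ := exists_nat_ge |p|
        refine le_iSup_of_le n (le_of_eq ?_)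
        rw [cutoffWeight, indicator_of_mem (mem_Icc.2 (abs_le.1 hn))]
      · exact indicator_le_self' (fun _ _ => by positivity) p
    simp only [hcov]
    rw [lintegral_iSup (fun n => (measurable_cutoffWeight m n).ennreal_ofReal)]
    · refine iSup_le fun n => ?_
      rw [← ofReal_integral_eq_lintegral_ofReal (integrable_cutoffWeight _ m n)
        (ae_of_all _ (cutoffWeight_nonneg m n))]
      exact ENNReal.ofReal_le_ofReal (hbound n)
    · intro a b hab p
      refine ENNReal.ofReal_le_ofReal ?_
      have hab' : (a : ℝ) ≤ b := by exact_mod_cast hab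
      exact indicator_le_indicator_of_subset (Icc_subset_Icc (neg_le_neg hab') hab')
        (fun _ => by positivity) p
  refine ⟨2 * m, ?_⟩
  have h1 := lintegral_mul_exp_abs_le hsymm (measurable_decay (2 * m))
    (fun p => by rw [decay, decay, abs_neg]) Real.pi
  have h2 : ∫⁻ p, decay (2 * m) p * ENNReal.ofReal (Real.exp (Real.pi * p)) ∂(P.scalar v)
      = ∫⁻ p, decay (2 * m) p * ENNReal.ofReal (Real.exp (-(Real.pi * p))) ∂(P.scalar v) := by
    conv_lhs => rw [← hsymm]
    have := measurable_decay (2 * m)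
    rw [lintegral_map (by fun_prop) measurable_neg]
    simp only [decay, abs_neg, mul_neg]
  refine h1.trans_lt (ENNReal.mul_lt_top (by simp) ?_)
  rw [h2]
  refine (lintegral_mono fun p => ?_).trans_lt (hlint.trans_lt ENNReal.ofReal_lt_top)
  rw [decay, ← ENNReal.ofReal_mul (by positivity), inv_mul_eq_div, pow_mul]
  refine ENNReal.ofReal_le_ofReal ?_
  have : 1 + p ^ 2 ≤ (1 + |p|) ^ 2 := by nlinarith [sq_abs p, abs_nonneg p]
  gcongr

end SpectralMeasure

/-! ### The equivalence -/

theorem mainTheorem5 {H : Type*} [NormedAddCommGroup H] [InnerProductSpace ℂ H] [CompleteSpace H]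
    (U : UnitaryOneParameterGroup H) (P : SpectralMeasure H) (hP : P.IsSpectralMeasureOf U)
    (J : H ≃ₗᵢ⋆[ℂ] H) (hJ : ∀ w, J (J w) = w) (hJU : ∀ t w, J (U.op t w) = U.op t (J w))
    (v : H) (hJv : J v = v) (hv : ∀ t : ℝ, |t| < Real.pi / 2 → v ∈ (P.expOp t).domain) :
    List.TFAE
      [v ∈ P.temperedVectors J,
       (∃ β : U.DistributionVectors,
          Tendsto (fun t : {t : ℝ // |t| < Real.pi / 2} =>
              U.toDistribution (P.expOp (-t.1) ⟨v, hv (-t.1) (by rw [abs_neg]; exact t.2)⟩))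
            (comap Subtype.val (𝓝 (Real.pi / 2))) (𝓝 β)) ∧
         (∃ β : U.DistributionVectors,
          Tendsto (fun t : {t : ℝ // |t| < Real.pi / 2} =>
              U.toDistribution (P.expOp (-t.1) ⟨v, hv (-t.1) (by rw [abs_neg]; exact t.2)⟩))
            (comap Subtype.val (𝓝 (-(Real.pi / 2)))) (𝓝 β)),
       ∃ C N : ℝ, 0 < C ∧ 0 < N ∧ ∀ (t : ℝ) (ht : |t| < Real.pi / 2),
         ‖P.expOp t ⟨v, hv t ht⟩‖ ^ 2 ≤ C * (Real.pi / 2 - |t|) ^ (-N) ∧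
         ‖P.expOp (-t) ⟨v, hv (-t) (by rw [abs_neg]; exact ht)⟩‖ ^ 2
           ≤ C * (Real.pi / 2 - |t|) ^ (-N)] := by
  have hsymm := SpectralMeasure.map_neg_scalar hP J hJU hJv
  have ha : v ∈ P.temperedVectors J ↔ SpectralMeasure.HasTemperedExpMoment (P.scalar v) :=
    (and_iff_right hJv).trans
      (SpectralMeasure.hasTemperateGrowth_iff_hasTemperedExpMoment hsymm)
  tfae_have 1 → 2 := fun h => by
    have hpi : |Real.pi / 2| = Real.pi / 2 := abs_of_nonneg (by positivity)
    exact ⟨(ha.1 h).exists_boundaryValue hP hv hpi.le,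
      (ha.1 h).exists_boundaryValue hP hv (by rw [abs_neg, hpi])⟩
  tfae_have 2 → 1 := fun ⟨⟨_, hβ⟩, _⟩ =>
    ha.2 (SpectralMeasure.hasTemperedExpMoment_of_tendsto hP hsymm hv hβ)
  tfae_have 1 → 3 := fun h => by
    obtain ⟨C, N, hC, hN, hCN⟩ := (ha.1 h).exists_bound
    have key : ∀ (t : ℝ) (ht : |t| < Real.pi / 2),
        ‖P.expOp t ⟨v, hv t ht⟩‖ ^ 2 ≤ C * (Real.pi / 2 - |t|) ^ (-N) := by
      intro t ht
      have hpos := sub_pos.2 ht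
      rw [← ENNReal.ofReal_le_ofReal_iff (by positivity),
        SpectralMeasure.ofReal_norm_expOp_sq]
      exact hCN t ht
    refine ⟨C, N, hC, hN, fun t ht => ⟨key t ht, ?_⟩⟩
    have := key (-t) (by rwa [abs_neg])
    simpa only [abs_neg] using this
  tfae_have 3 → 1 := fun ⟨C, N, hC, _, h⟩ => by
    refine ha.2 (SpectralMeasure.hasTemperedExpMoment_of_bound hsymm hC (N := N) fun t ht => ?_)
    rw [← SpectralMeasure.ofReal_norm_expOp_sq (hv t ht)]
    exact ENNReal.ofReal_le_ofReal (h t ht).1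
  tfae_finish
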